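/- **Setting.** Let $\mathrm{AdS}=\mathrm{SL}(2,\mathbb R)$, inside the space of real $2\times2$ matrices with the inner product $\langle\cdot,\cdot\rangle$ obtained by polarizing $q(X)=-\det X$. Let $J,I\subseteq\mathbb R$ be open intervals. A *family of null curves* is a smooth map $\gamma\colon J\times I\to\mathrm{AdS}$, $(s,t)\mapsto\gamma(s,t)$, such that for each $t$ the curve $s\mapsto\gamma(s,t)$ is immersed, null ($\langle\partial_s\gamma,\partial_s\gamma\rangle=0$), future-directed (the bivector $\gamma\wedge\partial_s\gamma$ pairs positively with $\begin{pmatrix}1&0\\0&1\end{pmatrix}\wedge\begin{pmatrix}0&1\\-1&0\end{pmatrix}$ in the induced inner product of bivectors), without inflection points ($\partial_s\gamma\wedge\partial_s^2\gamma\ne0$) and parameterized by proper time ($\langle\partial_s^2\gamma,\partial_s^2\gamma\rangle=4$). Its bending is $\kappa=-\frac1{16}\langle\partial_s^3\gamma,\partial_s^3\gamma\rangle$. It is a solution of the *LIEN flow* if $$\partial_t\gamma=2\,\partial_s^3\gamma-6\kappa\,\partial_s\gamma .$$ A *spinor frame field* along $\gamma$ is a pair of smooth maps $F_\pm\colon J\times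 I\to\mathrm{SL}(2,\mathbb R)$ with $\gamma=F_+F_-^{-1}$ and $\partial_sF_\pm=F_\pm\begin{pmatrix}0&\kappa\pm1\\1&0\end{pmatrix}$ (the pair is determined up to a common sign). For $\kappa\colon J\times I\to\mathbb R$ smooth and $\lambda\in\mathbb R$, the *Wahlquist–Estabrook equation* for $\kappa$ and $\lambda$ is the following equation for a smooth function $f\colon J\times I\to\mathbb R$: $$df=(\kappa-f^2+\lambda)\,ds+\bigl(4\lambda(f^2-\lambda)-2\kappa(f^2+\lambda)+2\kappa^2+2f\,\partial_s\kappa-\partial_s^2\kappa\bigr)\,dt .$$ Let $\gamma$ have bending $\kappa$ and spinor frame field $(F_+,F_-)$, let $\xi\neq0$, and let $f$ solve the Wahlquist–Estabrook equation for $\kappa$ and $\lambda=\cosh(2\xi)$. For a sign $\varepsilon=\pm1$, the *$\mathcal T$-transform of $\gamma$ with parameter $\xi$, transforming function $f$ and sign $\varepsilon$* is $$\mathcal T^{\varepsilon}_{\xi,f}(\gamma)=\varepsilon\,F_+\begin{pmatrix}\tanh\xi&-\operatorname{csch}\xi\,\operatorname{sech}\xi\,f\\0&\coth\xi\end{pmatrix}F_-^{-1}.$$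 **Theorem (permutability).** Let $\gamma\colon J\times I\to\mathrm{AdS}$ be a solution of the LIEN flow with bending $\kappa$, and let $\gamma_1=\mathcal T^{\varepsilon_1}_{\xi_1,f_1}(\gamma)$ and $\gamma_2=\mathcal T^{\varepsilon_2}_{\xi_2,f_2}(\gamma)$ be two $\mathcal T$-transforms of $\gamma$ with $\xi_1\ne\xi_2$ and $f_1(s,t)\neq f_2(s,t)$ for all $(s,t)\in J\times I$. Then $\gamma_1$ and $\gamma_2$ are solutions of the LIEN flow; let $\kappa_1,\kappa_2$ be their bendings and put $\lambda_i=\cosh(2\xi_i)$. The function $$f_{2\to1}=-f_1+\frac{\lambda_1-\lambda_2}{f_1-f_2}$$ solves the Wahlquist–Estabrook equation for $\kappa_1$ and $\lambda_2$, and the function $$f_{1\to2}=-f_2+\frac{\lambda_1-\lambda_2}{f_1-f_2}$$ solves the Wahlquist–Estabrook equation for $\kappa_2$ and $\lambda_1$. Both composite transforms $\mathcal T^{\varepsilon_2}_{\xi_2,f_{2\to1}}(\gamma_1)$ and $\mathcal T^{\varepsilon_1}_{\xi_1,f_{1\to2}}(\gamma_2)$ exist, and $$\mathcal T^{\varepsilon_2}_{\xi_2,f_{2\to1}}\bigl(\mathcal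 T^{\varepsilon_1}_{\xi_1,f_1}(\gamma)\bigr)=\mathcal T^{\varepsilon_1}_{\xi_1,f_{1\to2}}\bigl(\mathcal T^{\varepsilon_2}_{\xi_2,f_2}(\gamma)\bigr)\quad\text{on }J\times I.$$ This common composite is a solution of the LIEN flow and its bending is $$\kappa_{2\to1}=\kappa-2(\lambda_1-\lambda_2)\frac{f_1+f_2}{f_1-f_2}+2\Bigl(\frac{\lambda_1-\lambda_2}{f_1-f_2}\Bigr)^2 ,$$ which is a solution of the KdV equation $\partial_t u+\partial_s^3u-6u\,\partial_su=0$. -/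

import Mathlib

open scoped ContDiff

noncomputable section

namespace LIEN

/-- Real `2 × 2` matrices, the ambient vector space of signature `(2,2)`. -/
abbrev Mat : Type := Matrix (Fin 2) (Fin 2) ℝ

/-- Anti-de Sitter 3-space, in the model `SL(2,ℝ) ⊆ Mat`. -/
abbrev AdS : Type := Matrix.SpecialLinearGroup (Fin 2) ℝ

/-- The quadratic form `q(X) = -det X`. -/
def quad (X : Mat) : ℝ := -X.det

/-- The inner product obtained from `q` by polarization. -/
def ip (X Y : Mat) : ℝ := (quad (X + Y) - quad X - quad Y) / 2

/-- The induced inner product `⟪⟪U ∧ V, W ∧ Z⟫⟫` of bivectors. -/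
def bivectorIp (U V W Z : Mat) : ℝ :=
  Matrix.det !![ip U W, ip U Z; ip V W, ip V Z]

/-- `W ∧ Z` is a bivector of type `(-,0)` (nonzero, and the inner product restricted to the span
of `W, Z` is nonzero, negative semidefinite and degenerate) which is positive, i.e. it pairs
positively with the fixed bivector of type `(-,-)` that gives the time orientation. -/
structure IsPositiveBivector (W Z : Mat) : Prop where
  linearIndependent : LinearIndependent ℝ ![W, Z]
  seminegative : ∀ X ∈ Submodule.span ℝ {W, Z}, ip X X ≤ 0
  ne_zero : ∃ X ∈ Submodule.span ℝ {W, Z}, ip X X ≠ 0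
  degenerate : ∃ X ∈ Submodule.span ℝ {W, Z}, X ≠ 0 ∧ ∀ Y ∈ Submodule.span ℝ {W, Z}, ip X Y = 0
  positive : 0 < bivectorIp (1 : Mat) !![0, 1; -1, 0] W Z

/-- `∂ₛ g` for a function `g(s,t)`. -/
def pds (g : ℝ → ℝ → ℝ) (s t : ℝ) : ℝ := deriv (fun x => g x t) s

/-- `∂ₜ g` for a function `g(s,t)`. -/
def pdt (g : ℝ → ℝ → ℝ) (s t : ℝ) : ℝ := deriv (fun x => g s x) t

/-- `∂ₛ G` (entry by entry) for a matrix-valued function `G(s,t)`. -/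
def mds (G : ℝ → ℝ → Mat) (s t : ℝ) : Mat :=
  Matrix.of fun i j => pds (fun x y => G x y i j) s t

/-- `∂ₜ G` (entry by entry) for a matrix-valued function `G(s,t)`. -/
def mdt (G : ℝ → ℝ → Mat) (s t : ℝ) : Mat :=
  Matrix.of fun i j => pdt (fun x y => G x y i j) s t

/-- `g` is smooth on `J × I`. -/
def SmoothOn (J I : Set ℝ) (g : ℝ → ℝ → ℝ) : Prop :=
  ContDiffOn ℝ ∞ (fun p : ℝ × ℝ => g p.1 p.2) (J ×ˢ I)

/-- A map into `SL(2,ℝ)` regarded as a matrix-valued map. -/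
def toMat (γ : ℝ → ℝ → AdS) (s t : ℝ) : Mat := (γ s t : Mat)

/-- A map `J × I → SL(2,ℝ)` is smooth if its entries are. -/
def AdSSmoothOn (J I : Set ℝ) (γ : ℝ → ℝ → AdS) : Prop :=
  ∀ i j, SmoothOn J I fun s t => toMat γ s t i j

/-- A smooth one-parameter family of future-directed null curves in AdS without inflection points,
each parameterized by proper time. -/
structure IsNullCurveFamily (J I : Set ℝ) (γ : ℝ → ℝ → AdS) : Prop where
  smooth : AdSSmoothOn J I γ
  immersed : ∀ s ∈ J, ∀ t ∈ I, mds (toMat γ) s t ≠ 0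
  null : ∀ s ∈ J, ∀ t ∈ I, ip (mds (toMat γ) s t) (mds (toMat γ) s t) = 0
  future : ∀ s ∈ J, ∀ t ∈ I, IsPositiveBivector (toMat γ s t) (mds (toMat γ) s t)
  noInflection : ∀ s ∈ J, ∀ t ∈ I,
    LinearIndependent ℝ ![mds (toMat γ) s t, mds (mds (toMat γ)) s t]
  properTime : ∀ s ∈ J, ∀ t ∈ I,
    ip (mds (mds (toMat γ)) s t) (mds (mds (toMat γ)) s t) = 4

/-- The bending `κ = -(1/16) ⟨∂ₛ³γ, ∂ₛ³γ⟩`. -/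
def bending (γ : ℝ → ℝ → AdS) (s t : ℝ) : ℝ :=
  -(1 / 16) * ip (mds (mds (mds (toMat γ))) s t) (mds (mds (mds (toMat γ))) s t)

/-- Solutions of the LIEN flow `∂ₜγ = 2 ∂ₛ³γ - 6 κ ∂ₛγ` on `J × I`. -/
structure IsLIENSolution (J I : Set ℝ) (γ : ℝ → ℝ → AdS) : Prop where
  nullCurves : IsNullCurveFamily J I γ
  flow : ∀ s ∈ J, ∀ t ∈ I, mdt (toMat γ) s t =
    (2 : ℝ) • mds (mds (mds (toMat γ))) s t - (6 * bending γ s t) • mds (toMat γ) s t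

/-- `(F₊, F₋)` is a spinor frame field along `γ`. -/
structure IsSpinorFrame (J I : Set ℝ) (γ Fp Fm : ℝ → ℝ → AdS) : Prop where
  smooth_p : AdSSmoothOn J I Fp
  smooth_m : AdSSmoothOn J I Fm
  lift : ∀ s ∈ J, ∀ t ∈ I, γ s t = Fp s t * (Fm s t)⁻¹
  frenet_p : ∀ s ∈ J, ∀ t ∈ I,
    mds (toMat Fp) s t = toMat Fp s t * !![0, bending γ s t + 1; 1, 0]
  frenet_m : ∀ s ∈ J, ∀ t ∈ I,
    mds (toMat Fm) s t = toMat Fm s t * !![0, bending γ s t - 1; 1, 0]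

/-- Smooth solutions on `J × I` of the KdV equation `∂ₜκ + ∂ₛ³κ - 6 κ ∂ₛκ = 0`. -/
structure IsKdVSolution (J I : Set ℝ) (κ : ℝ → ℝ → ℝ) : Prop where
  smooth : SmoothOn J I κ
  kdv : ∀ s ∈ J, ∀ t ∈ I,
    pdt κ s t + pds (pds (pds κ)) s t - 6 * κ s t * pds κ s t = 0

/-- Smooth solutions `f` on `J × I` of the Wahlquist–Estabrook equation for `κ` and `l`:
`df = (κ - f² + l) ds + (4l(f² - l) - 2κ(f² + l) + 2κ² + 2f ∂ₛκ - ∂ₛ²κ) dt`. -/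
structure IsWESolution (J I : Set ℝ) (κ : ℝ → ℝ → ℝ) (l : ℝ) (f : ℝ → ℝ → ℝ) : Prop where
  smooth : SmoothOn J I f
  equation : ∀ s ∈ J, ∀ t ∈ I,
    HasFDerivAt (fun p : ℝ × ℝ => f p.1 p.2)
      ((κ s t - f s t ^ 2 + l) • ContinuousLinearMap.fst ℝ ℝ ℝ +
        (4 * l * (f s t ^ 2 - l) - 2 * κ s t * (f s t ^ 2 + l) + 2 * κ s t ^ 2
          + 2 * f s t * pds κ s t - pds (pds κ) s t) • ContinuousLinearMap.snd ℝ ℝ ℝ)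
      (s, t)

/-- The matrix with rows `(tanh ξ, -csch ξ sech ξ · y)` and `(0, coth ξ)`. -/
def transformMatrix (ξ y : ℝ) : Mat :=
  !![Real.tanh ξ, -((Real.sinh ξ)⁻¹ * (Real.cosh ξ)⁻¹ * y); 0, Real.cosh ξ / Real.sinh ξ]

/-- `γ'` is, on `J × I`, the `𝒯`-transform of `γ` with parameter `ξ ≠ 0` and transforming function
`f`, a solution of the Wahlquist–Estabrook equation for the bending of `γ` and `cosh (2ξ)`:
`γ' = ε F₊ (transformMatrix ξ f) F₋⁻¹`, where `(F₊, F₋)` is the spinor frame field along `γ` and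
`ε = ±1` is the chosen sign. The values of maps outside `J × I` are irrelevant. -/
structure IsTTransform (J I : Set ℝ) (ε : ℤˣ) (ξ : ℝ) (f : ℝ → ℝ → ℝ)
    (γ γ' : ℝ → ℝ → AdS) : Prop where
  parameter_ne_zero : ξ ≠ 0
  wahlquistEstabrook : IsWESolution J I (bending γ) (Real.cosh (2 * ξ)) f
  transform : ∃ Fp Fm : ℝ → ℝ → AdS, IsSpinorFrame J I γ Fp Fm ∧
    ∀ s ∈ J, ∀ t ∈ I, toMat γ' s t =
      (ε : ℤ) • (toMat Fp s t * transformMatrix ξ (f s t) * ((Fm s t)⁻¹ : AdS).val)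

/-- `(cosh 2ξ₁ - cosh 2ξ₂) / (f₁ - f₂)`. -/
def quotientTerm (ξ₁ ξ₂ : ℝ) (f₁ f₂ : ℝ → ℝ → ℝ) (s t : ℝ) : ℝ :=
  (Real.cosh (2 * ξ₁) - Real.cosh (2 * ξ₂)) / (f₁ s t - f₂ s t)

/-- `f_{2→1} = -f₁ + (cosh 2ξ₁ - cosh 2ξ₂) / (f₁ - f₂)`. -/
def f21 (ξ₁ ξ₂ : ℝ) (f₁ f₂ : ℝ → ℝ → ℝ) (s t : ℝ) : ℝ :=
  -f₁ s t + quotientTerm ξ₁ ξ₂ f₁ f₂ s t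

/-- `f_{1→2} = -f₂ + (cosh 2ξ₁ - cosh 2ξ₂) / (f₁ - f₂)`. -/
def f12 (ξ₁ ξ₂ : ℝ) (f₁ f₂ : ℝ → ℝ → ℝ) (s t : ℝ) : ℝ :=
  -f₂ s t + quotientTerm ξ₁ ξ₂ f₁ f₂ s t

/-- `κ_{2→1} = κ - 2 (cosh 2ξ₁ - cosh 2ξ₂) (f₁ + f₂)/(f₁ - f₂)
+ 2 ((cosh 2ξ₁ - cosh 2ξ₂)/(f₁ - f₂))²`. -/
def kappa21 (κ : ℝ → ℝ → ℝ) (ξ₁ ξ₂ : ℝ) (f₁ f₂ : ℝ → ℝ → ℝ) (s t : ℝ) : ℝ :=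
  κ s t
    - 2 * (Real.cosh (2 * ξ₁) - Real.cosh (2 * ξ₂)) * ((f₁ s t + f₂ s t) / (f₁ s t - f₂ s t))
    + 2 * quotientTerm ξ₁ ξ₂ f₁ f₂ s t ^ 2

end LIEN

end

open scoped ContDiff

noncomputable section

namespace LIEN

/-! ### Smooth functions of two variables -/

section Scalar

variable {J I : Set ℝ} {g h : ℝ → ℝ → ℝ} {s t : ℝ}

/-! A null curve `γ = F₊ F₋⁻¹` follows the LIEN flow exactly when its spinor frames solve the Lax
pair of KdV with potential the bending, `F₊` at spectral parameter `1` and `F₋` at `-1`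
(`isLIENSolution_of_isExtendedFrame`, `IsLIENSolution.isExtendedFrame`). The compatibility of that
Lax pair is KdV for the bending.

A `𝒯`-transform is a Darboux transformation of both frames: `F₊` and `F₋` are multiplied on the
right by the normalized Darboux matrices at `m = 1` and `m = -1`, and the quotient of these two
matrices is the transform matrix with its sign (`sandwich_darbouxSL`). The Wahlquist–Estabrook
equation makes the new frames solve the Lax pair with potential `2f² - κ - 2λ`
(`IsExtendedFrame.darboux`), so the transform is again a LIEN solution.

Permutability then becomes algebra. The functions `f21` and `f12` solve the new Wahlquist–Estabrook
equations (`IsWESolution.superposition`), and the two products of Darboux matrices agree at every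
spectral parameter (`darboux_mul_darboux_comm`). Hence both orders give the same frames and the same
curve, and iterating the formula for the potential gives `kappa21`. -/

lemma SmoothOn.add (hg : SmoothOn J I g) (hh : SmoothOn J I h) :
    SmoothOn J I fun s t => g s t + h s t := ContDiffOn.add hg hh

lemma SmoothOn.sub (hg : SmoothOn J I g) (hh : SmoothOn J I h) :
    SmoothOn J I fun s t => g s t - h s t := ContDiffOn.sub hg hh

lemma SmoothOn.mul (hg : SmoothOn J I g) (hh : SmoothOn J I h) :
    SmoothOn J I fun s t => g s t * h s t := ContDiffOn.mul hg hh

lemma SmoothOn.neg (hg : SmoothOn J I g) : SmoothOn J I fun s t => -g s t := ContDiffOn.neg hg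

lemma SmoothOn.pow (hg : SmoothOn J I g) (n : ℕ) : SmoothOn J I fun s t => g s t ^ n :=
  ContDiffOn.pow hg n

lemma SmoothOn.div (hg : SmoothOn J I g) (hh : SmoothOn J I h)
    (h0 : ∀ s ∈ J, ∀ t ∈ I, h s t ≠ 0) : SmoothOn J I fun s t => g s t / h s t :=
  ContDiffOn.div hg hh fun p hp => h0 p.1 hp.1 p.2 hp.2

lemma smoothOn_const (c : ℝ) : SmoothOn J I fun _ _ => c := contDiffOn_const

lemma SmoothOn.congr (hg : SmoothOn J I g) (e : ∀ s ∈ J, ∀ t ∈ I, h s t = g s t) :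
    SmoothOn J I h := ContDiffOn.congr hg fun p hp => e p.1 hp.1 p.2 hp.2

lemma pds_congr (hJ : IsOpen J) (e : ∀ s ∈ J, ∀ t ∈ I, g s t = h s t) (hs : s ∈ J) (ht : t ∈ I) :
    pds g s t = pds h s t := by
  refine Filter.EventuallyEq.deriv_eq ?_
  filter_upwards [hJ.mem_nhds hs] with x hx using e x hx t ht

lemma pdt_congr (hI : IsOpen I) (e : ∀ s ∈ J, ∀ t ∈ I, g s t = h s t) (hs : s ∈ J) (ht : t ∈ I) :
    pdt g s t = pdt h s t := by
  refine Filter.EventuallyEq.deriv_eq ?_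
  filter_upwards [hI.mem_nhds ht] with x hx using e s hs x hx

lemma SmoothOn.contDiffAt (hJ : IsOpen J) (hI : IsOpen I) (hg : SmoothOn J I g)
    (hs : s ∈ J) (ht : t ∈ I) : ContDiffAt ℝ ∞ (fun p : ℝ × ℝ => g p.1 p.2) (s, t) :=
  ContDiffOn.contDiffAt hg ((hJ.prod hI).mem_nhds ⟨hs, ht⟩)

lemma SmoothOn.hasFDerivAt (hJ : IsOpen J) (hI : IsOpen I) (hg : SmoothOn J I g)
    (hs : s ∈ J) (ht : t ∈ I) : HasFDerivAt (fun p : ℝ × ℝ => g p.1 p.2)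
      (fderiv ℝ (fun p : ℝ × ℝ => g p.1 p.2) (s, t)) (s, t) :=
  ((hg.contDiffAt hJ hI hs ht).differentiableAt (by simp)).hasFDerivAt

lemma hasDerivAt_fst_of_hasFDerivAt {L : ℝ × ℝ →L[ℝ] ℝ}
    (hg : HasFDerivAt (fun p : ℝ × ℝ => g p.1 p.2) L (s, t)) :
    HasDerivAt (fun x => g x t) (L (1, 0)) s :=
  hg.comp_hasDerivAt (f := fun x : ℝ => (x, t)) s ((hasDerivAt_id s).prodMk (hasDerivAt_const s t))

lemma hasDerivAt_snd_of_hasFDerivAt {L : ℝ × ℝ →L[ℝ] ℝ}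
    (hg : HasFDerivAt (fun p : ℝ × ℝ => g p.1 p.2) L (s, t)) :
    HasDerivAt (fun x => g s x) (L (0, 1)) t :=
  hg.comp_hasDerivAt (f := fun x : ℝ => (s, x)) t ((hasDerivAt_const t s).prodMk (hasDerivAt_id t))

lemma SmoothOn.hasDerivAt_pds (hJ : IsOpen J) (hI : IsOpen I) (hg : SmoothOn J I g)
    (hs : s ∈ J) (ht : t ∈ I) : HasDerivAt (fun x => g x t) (pds g s t) s :=
  (hasDerivAt_fst_of_hasFDerivAt
    (hg.hasFDerivAt hJ hI hs ht)).differentiableAt.hasDerivAt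

lemma SmoothOn.hasDerivAt_pdt (hJ : IsOpen J) (hI : IsOpen I) (hg : SmoothOn J I g)
    (hs : s ∈ J) (ht : t ∈ I) : HasDerivAt (fun x => g s x) (pdt g s t) t :=
  (hasDerivAt_snd_of_hasFDerivAt
    (hg.hasFDerivAt hJ hI hs ht)).differentiableAt.hasDerivAt

lemma SmoothOn.pds_eq_fderiv (hJ : IsOpen J) (hI : IsOpen I) (hg : SmoothOn J I g)
    (hs : s ∈ J) (ht : t ∈ I) :
    pds g s t = fderiv ℝ (fun p : ℝ × ℝ => g p.1 p.2) (s, t) (1, 0) :=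
  (hasDerivAt_fst_of_hasFDerivAt (hg.hasFDerivAt hJ hI hs ht)).deriv

lemma SmoothOn.pdt_eq_fderiv (hJ : IsOpen J) (hI : IsOpen I) (hg : SmoothOn J I g)
    (hs : s ∈ J) (ht : t ∈ I) :
    pdt g s t = fderiv ℝ (fun p : ℝ × ℝ => g p.1 p.2) (s, t) (0, 1) :=
  (hasDerivAt_snd_of_hasFDerivAt (hg.hasFDerivAt hJ hI hs ht)).deriv

lemma SmoothOn.fderiv_apply (hJ : IsOpen J) (hI : IsOpen I) (hg : SmoothOn J I g) (v : ℝ × ℝ) :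
    SmoothOn J I fun s t => fderiv ℝ (fun p : ℝ × ℝ => g p.1 p.2) (s, t) v :=
  (ContDiffOn.fderiv_of_isOpen (m := ∞) hg (hJ.prod hI) (by simp)).clm_apply contDiffOn_const

lemma SmoothOn.pds (hJ : IsOpen J) (hI : IsOpen I) (hg : SmoothOn J I g) :
    SmoothOn J I (pds g) :=
  (hg.fderiv_apply hJ hI (1, 0)).congr fun _ hs _ ht => hg.pds_eq_fderiv hJ hI hs ht

lemma SmoothOn.pdt (hJ : IsOpen J) (hI : IsOpen I) (hg : SmoothOn J I g) :
    SmoothOn J I (pdt g) :=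
  (hg.fderiv_apply hJ hI (0, 1)).congr fun _ hs _ ht => hg.pdt_eq_fderiv hJ hI hs ht

/-- Iterated partial derivatives become values of the second Fréchet derivative, whose symmetry then
yields equality of mixed partials. -/
lemma SmoothOn.fderiv_fderiv_apply (hJ : IsOpen J) (hI : IsOpen I) (hg : SmoothOn J I g)
    (hs : s ∈ J) (ht : t ∈ I) (v w : ℝ × ℝ) :
    fderiv ℝ (fun p : ℝ × ℝ => fderiv ℝ (fun p : ℝ × ℝ => g p.1 p.2) (p.1, p.2) v) (s, t) w =
      fderiv ℝ (fderiv ℝ (fun p : ℝ × ℝ => g p.1 p.2)) (s, t) w v := by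
  have h1 : ContDiffAt ℝ ∞ (fderiv ℝ (fun p : ℝ × ℝ => g p.1 p.2)) (s, t) :=
    (hg.contDiffAt hJ hI hs ht).fderiv_right (by simp)
  have h2 := (h1.differentiableAt (by simp)).hasFDerivAt.clm_apply (hasFDerivAt_const v (s, t))
  simpa using DFunLike.congr_fun h2.fderiv w

lemma SmoothOn.pds_pdt_comm (hJ : IsOpen J) (hI : IsOpen I) (hg : SmoothOn J I g)
    (hs : s ∈ J) (ht : t ∈ I) : LIEN.pds (LIEN.pdt g) s t = LIEN.pdt (LIEN.pds g) s t := by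
  rw [pds_congr hJ (fun s hs t ht => hg.pdt_eq_fderiv hJ hI hs ht) hs ht,
    pdt_congr hI (fun s hs t ht => hg.pds_eq_fderiv hJ hI hs ht) hs ht,
    (hg.fderiv_apply hJ hI (0, 1)).pds_eq_fderiv hJ hI hs ht,
    (hg.fderiv_apply hJ hI (1, 0)).pdt_eq_fderiv hJ hI hs ht,
    hg.fderiv_fderiv_apply hJ hI hs ht, hg.fderiv_fderiv_apply hJ hI hs ht]
  exact ((hg.contDiffAt hJ hI hs ht).isSymmSndFDerivAt
    (by simpa using WithTop.coe_le_coe.2 (le_top : (2 : ℕ∞) ≤ ⊤))).eq _ _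

end Scalar

/-! ### Smooth matrix-valued functions of two variables -/

/-- A matrix-valued map is smooth on `J × I` if its entries are. -/
def MatSmoothOn (J I : Set ℝ) (G : ℝ → ℝ → Mat) : Prop :=
  ∀ i j, SmoothOn J I fun s t => G s t i j

section Matrices

variable {J I : Set ℝ} {G H : ℝ → ℝ → Mat} {s t : ℝ}

lemma MatSmoothOn.congr (hG : MatSmoothOn J I G) (e : ∀ s ∈ J, ∀ t ∈ I, H s t = G s t) :
    MatSmoothOn J I H := fun i j => (hG i j).congr fun s hs t ht => by rw [e s hs t ht]

lemma MatSmoothOn.mul (hG : MatSmoothOn J I G) (hH : MatSmoothOn J I H) :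
    MatSmoothOn J I fun s t => G s t * H s t := fun i j => by
  simp only [Matrix.mul_apply, Fin.sum_univ_two]
  exact ((hG i 0).mul (hH 0 j)).add ((hG i 1).mul (hH 1 j))

lemma MatSmoothOn.smul (hG : MatSmoothOn J I G) (c : ℝ) :
    MatSmoothOn J I fun s t => c • G s t := fun i j => by
  simpa using (smoothOn_const c).mul (hG i j)

lemma matSmoothOn_of {a b c d : ℝ → ℝ → ℝ} (ha : SmoothOn J I a) (hb : SmoothOn J I b)
    (hc : SmoothOn J I c) (hd : SmoothOn J I d) :
    MatSmoothOn J I fun s t => !![a s t, b s t; c s t, d s t] := fun i j => by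
  fin_cases i <;> fin_cases j <;> simpa

lemma matSmoothOn_const (K : Mat) : MatSmoothOn J I fun _ _ => K := fun i j =>
  smoothOn_const (K i j)

lemma MatSmoothOn.adjugate (hG : MatSmoothOn J I G) :
    MatSmoothOn J I fun s t => (G s t).adjugate := by
  simp only [Matrix.adjugate_fin_two]
  exact matSmoothOn_of (hG 1 1) (hG 0 1).neg (hG 1 0).neg (hG 0 0)

lemma MatSmoothOn.mds (hJ : IsOpen J) (hI : IsOpen I) (hG : MatSmoothOn J I G) :
    MatSmoothOn J I (mds G) := fun i j => (hG i j).pds hJ hI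

lemma MatSmoothOn.mdt (hJ : IsOpen J) (hI : IsOpen I) (hG : MatSmoothOn J I G) :
    MatSmoothOn J I (mdt G) := fun i j => (hG i j).pdt hJ hI

lemma mds_congr (hJ : IsOpen J) (e : ∀ s ∈ J, ∀ t ∈ I, G s t = H s t) (hs : s ∈ J) (ht : t ∈ I) :
    mds G s t = mds H s t := by
  ext i j
  exact pds_congr (g := fun s t => G s t i j) (h := fun s t => H s t i j) hJ
    (fun s hs t ht => by rw [e s hs t ht]) hs ht

lemma mdt_congr (hI : IsOpen I) (e : ∀ s ∈ J, ∀ t ∈ I, G s t = H s t) (hs : s ∈ J) (ht : t ∈ I) :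
    mdt G s t = mdt H s t := by
  ext i j
  exact pdt_congr (g := fun s t => G s t i j) (h := fun s t => H s t i j) hI
    (fun s hs t ht => by rw [e s hs t ht]) hs ht

lemma mds_of (a b c d : ℝ → ℝ → ℝ) (s t : ℝ) :
    mds (fun s t => !![a s t, b s t; c s t, d s t]) s t =
      !![pds a s t, pds b s t; pds c s t, pds d s t] := by
  ext i j
  fin_cases i <;> fin_cases j <;> rfl

lemma mdt_of (a b c d : ℝ → ℝ → ℝ) (s t : ℝ) :
    mdt (fun s t => !![a s t, b s t; c s t, d s t]) s t =
      !![pdt a s t, pdt b s t; pdt c s t, pdt d s t] := by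
  ext i j
  fin_cases i <;> fin_cases j <;> rfl

lemma mds_const (K : Mat) (s t : ℝ) : mds (fun _ _ => K) s t = 0 := by
  ext i j
  simp [mds, pds]

lemma mdt_const (K : Mat) (s t : ℝ) : mdt (fun _ _ => K) s t = 0 := by
  ext i j
  simp [mdt, pdt]

lemma mds_smul (c : ℝ) (G : ℝ → ℝ → Mat) (s t : ℝ) :
    mds (fun s t => c • G s t) s t = c • mds G s t := by
  ext i j
  simp [mds, pds]

lemma mdt_smul (c : ℝ) (G : ℝ → ℝ → Mat) (s t : ℝ) :
    mdt (fun s t => c • G s t) s t = c • mdt G s t := by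
  ext i j
  simp [mdt, pdt]

/-- For 2×2 matrices the adjugate only permutes entries and changes signs. On `SL(2,ℝ)` it is the
inverse, so inverses can be differentiated linearly. -/
lemma mds_adjugate (G : ℝ → ℝ → Mat) (s t : ℝ) :
    mds (fun s t => (G s t).adjugate) s t = (mds G s t).adjugate := by
  simp only [Matrix.adjugate_fin_two]
  ext i j
  fin_cases i <;> fin_cases j <;> simp [mds, pds]

lemma mdt_adjugate (G : ℝ → ℝ → Mat) (s t : ℝ) :
    mdt (fun s t => (G s t).adjugate) s t = (mdt G s t).adjugate := by
  simp only [Matrix.adjugate_fin_two]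
  ext i j
  fin_cases i <;> fin_cases j <;> simp [mdt, pdt]

lemma mds_mul (hJ : IsOpen J) (hI : IsOpen I) (hG : MatSmoothOn J I G) (hH : MatSmoothOn J I H)
    (hs : s ∈ J) (ht : t ∈ I) :
    mds (fun s t => G s t * H s t) s t = mds G s t * H s t + G s t * mds H s t := by
  ext i j
  have hd := (((hG i 0).hasDerivAt_pds hJ hI hs ht).mul ((hH 0 j).hasDerivAt_pds hJ hI hs ht)).add
    (((hG i 1).hasDerivAt_pds hJ hI hs ht).mul ((hH 1 j).hasDerivAt_pds hJ hI hs ht))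
  simp only [mds, Matrix.mul_apply, Fin.sum_univ_two, Matrix.of_apply, Matrix.add_apply]
  refine hd.deriv.trans ?_
  ring

lemma mdt_mul (hJ : IsOpen J) (hI : IsOpen I) (hG : MatSmoothOn J I G) (hH : MatSmoothOn J I H)
    (hs : s ∈ J) (ht : t ∈ I) :
    mdt (fun s t => G s t * H s t) s t = mdt G s t * H s t + G s t * mdt H s t := by
  ext i j
  have hd := (((hG i 0).hasDerivAt_pdt hJ hI hs ht).mul ((hH 0 j).hasDerivAt_pdt hJ hI hs ht)).add
    (((hG i 1).hasDerivAt_pdt hJ hI hs ht).mul ((hH 1 j).hasDerivAt_pdt hJ hI hs ht))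
  simp only [mdt, Matrix.mul_apply, Fin.sum_univ_two, Matrix.of_apply, Matrix.add_apply]
  refine hd.deriv.trans ?_
  ring

lemma MatSmoothOn.mds_mdt_comm (hJ : IsOpen J) (hI : IsOpen I) (hG : MatSmoothOn J I G)
    (hs : s ∈ J) (ht : t ∈ I) : LIEN.mds (LIEN.mdt G) s t = LIEN.mdt (LIEN.mds G) s t := by
  ext i j
  exact (hG i j).pds_pdt_comm hJ hI hs ht

end Matrices

/-! ### The action of `SL(2,ℝ) × SL(2,ℝ)` on matrices -/

/-- The action `K ↦ A K B⁻¹` of `SL(2,ℝ) × SL(2,ℝ)` on matrices. -/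
def sandwich (A B : AdS) (K : Mat) : Mat := (A : Mat) * K * ((B⁻¹ : AdS) : Mat)

section Sandwich

variable (A B : AdS) (K L : Mat) (c : ℝ)

lemma coe_inv_mul_coe : ((A⁻¹ : AdS) : Mat) * (A : Mat) = 1 := by
  rw [← Matrix.SpecialLinearGroup.coe_mul, inv_mul_cancel, Matrix.SpecialLinearGroup.coe_one]

lemma coe_mul_left_cancel {K L : Mat} (h : (A : Mat) * K = A * L) : K = L := by
  have := congrArg (((A⁻¹ : AdS) : Mat) * ·) h
  simpa only [← mul_assoc, coe_inv_mul_coe, one_mul] using this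

lemma sandwich_injective {K L : Mat} (h : sandwich A B K = sandwich A B L) : K = L := by
  have := congrArg (· * (B : Mat)) h
  simp only [sandwich, mul_assoc, coe_inv_mul_coe, mul_one] at this
  exact coe_mul_left_cancel A this

lemma sandwich_add : sandwich A B (K + L) = sandwich A B K + sandwich A B L := by
  simp [sandwich, mul_add, add_mul]

lemma sandwich_sub : sandwich A B (K - L) = sandwich A B K - sandwich A B L := by
  simp [sandwich, mul_sub, sub_mul]

lemma sandwich_smul : sandwich A B (c • K) = c • sandwich A B K := by
  simp [sandwich]

lemma sandwich_zero : sandwich A B 0 = 0 := by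
  simp [sandwich]

lemma sandwich_eq_zero {K : Mat} (h : sandwich A B K = 0) : K = 0 :=
  sandwich_injective A B (h.trans (sandwich_zero A B).symm)

lemma quad_sandwich : quad (sandwich A B K) = quad K := by
  simp only [quad, sandwich, Matrix.det_mul, Matrix.SpecialLinearGroup.det_coe, one_mul, mul_one]

/-- The action preserves determinants, so it is isometric, and metric conditions on a curve reduce
to computations with the matrices that represent its derivatives in the frame. -/
lemma ip_sandwich : ip (sandwich A B K) (sandwich A B L) = ip K L := by
  simp only [ip, ← sandwich_add, quad_sandwich]

lemma ip_fin_two (a b c d a' b' c' d' : ℝ) :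
    ip !![a, b; c, d] !![a', b'; c', d'] = -(a * d' + d * a' - b * c' - c * b') / 2 := by
  simp [ip, quad, Matrix.det_fin_two]
  ring

lemma sandwich_linearIndependent {K L : Mat} (h : LinearIndependent ℝ ![K, L]) :
    LinearIndependent ℝ ![sandwich A B K, sandwich A B L] := by
  rw [LinearIndependent.pair_iff] at h ⊢
  intro a b hab
  rw [← sandwich_smul, ← sandwich_smul, ← sandwich_add] at hab
  exact h a b (sandwich_eq_zero A B hab)

/-- These two matrices are the position and the velocity of a curve with spinor frame `(A, B)`, so
this is future-directedness. -/
lemma isPositiveBivector_sandwich :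
    IsPositiveBivector (sandwich A B 1) (sandwich A B !![0, 2; 0, 0]) := by
  have hone : (1 : Mat) = !![1, 0; 0, 1] := Matrix.one_fin_two
  have hcomb (a b : ℝ) : a • sandwich A B 1 + b • sandwich A B !![0, 2; 0, 0] =
      sandwich A B !![a, 2 * b; 0, a] := by
    rw [← sandwich_smul, ← sandwich_smul, ← sandwich_add]
    congr 1
    ext i j
    fin_cases i <;> fin_cases j <;> simp [mul_comm]
  refine ⟨?_, ?_, ?_, ?_, ?_⟩
  · refine sandwich_linearIndependent A B ?_
    rw [LinearIndependent.pair_iff]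
    intro a b hab
    have h0 := congrFun (congrFun hab 0) 0
    have h1 := congrFun (congrFun hab 0) 1
    simp at h0 h1
    exact ⟨h0, h1⟩
  · intro X hX
    obtain ⟨a, b, rfl⟩ := Submodule.mem_span_pair.1 hX
    rw [hcomb, ip_sandwich, ip_fin_two]
    nlinarith [sq_nonneg a]
  · refine ⟨sandwich A B 1, Submodule.subset_span (by simp), ?_⟩
    rw [ip_sandwich, hone, ip_fin_two]
    norm_num
  · refine ⟨sandwich A B !![0, 2; 0, 0], Submodule.subset_span (by simp), ?_, ?_⟩
    · intro h
      have := congrFun (congrFun (sandwich_eq_zero A B h) 0) 1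
      simp at this
    · intro Y hY
      obtain ⟨a, b, rfl⟩ := Submodule.mem_span_pair.1 hY
      rw [hcomb, ip_sandwich, ip_fin_two]
      ring
  · have hA : A 0 0 * A 1 1 - A 0 1 * A 1 0 = 1 := by rw [← Matrix.det_fin_two]; exact A.2
    have hB : B 0 0 * B 1 1 - B 0 1 * B 1 0 = 1 := by rw [← Matrix.det_fin_two]; exact B.2
    have hA' : 0 < A 0 0 ^ 2 + A 1 0 ^ 2 := by
      by_contra h
      have h0 : A 0 0 = 0 := by nlinarith [sq_nonneg (A 0 0), sq_nonneg (A 1 0)]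
      have h1 : A 1 0 = 0 := by nlinarith [sq_nonneg (A 0 0), sq_nonneg (A 1 0)]
      simp [h0, h1] at hA
    have hB' : 0 < B 0 0 ^ 2 + B 1 0 ^ 2 := by
      by_contra h
      have h0 : B 0 0 = 0 := by nlinarith [sq_nonneg (B 0 0), sq_nonneg (B 1 0)]
      have h1 : B 1 0 = 0 := by nlinarith [sq_nonneg (B 0 0), sq_nonneg (B 1 0)]
      simp [h0, h1] at hB
    -- The determinants of `A` and `B` are kept as factors so that this is a polynomial identity.
    -- Once they equal `1`, it is half the sum of the squared lengths of the first columns, which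
    -- are nonzero.
    have key : bivectorIp (1 : Mat) !![0, 1; -1, 0] (sandwich A B 1)
        (sandwich A B !![0, 2; 0, 0]) =
        ((A 0 0 ^ 2 + A 1 0 ^ 2) * (B 0 0 * B 1 1 - B 0 1 * B 1 0) +
          (B 0 0 ^ 2 + B 1 0 ^ 2) * (A 0 0 * A 1 1 - A 0 1 * A 1 0)) / 2 := by
      simp only [bivectorIp, sandwich, Matrix.SpecialLinearGroup.coe_inv, Matrix.adjugate_fin_two]
      rw [Matrix.eta_fin_two (A : Mat), hone]
      simp only [Matrix.mul_fin_two, ip_fin_two, Matrix.det_fin_two_of, Matrix.of_apply,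
        Matrix.cons_val]
      ring
    rw [key, hA, hB]
    positivity

end Sandwich

section Derivatives

variable {J I : Set ℝ} {Fp Fm : ℝ → ℝ → AdS} {K : ℝ → ℝ → Mat} {U W : Mat} {s t : ℝ}

lemma adjugate_eq_neg (hW : W.trace = 0) : W.adjugate = -W := by
  rw [Matrix.trace_fin_two] at hW
  rw [Matrix.adjugate_fin_two]
  ext i j
  fin_cases i <;> fin_cases j <;> simp <;> linarith

lemma AdSSmoothOn.sandwich (hp : AdSSmoothOn J I Fp) (hm : AdSSmoothOn J I Fm)
    (hK : MatSmoothOn J I K) :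
    MatSmoothOn J I fun s t => LIEN.sandwich (Fp s t) (Fm s t) (K s t) := by
  simp only [LIEN.sandwich, Matrix.SpecialLinearGroup.coe_inv]
  exact (MatSmoothOn.mul (G := toMat Fp) hp hK).mul (MatSmoothOn.adjugate (G := toMat Fm) hm)

/-- Since `W` is trace-free, its adjugate is `-W`, and the product rule turns differentiation of the
curve into the operator `K ↦ U K + ∂ₛK - K W` in the frame. -/
lemma mds_sandwich (hJ : IsOpen J) (hI : IsOpen I) (hp : AdSSmoothOn J I Fp)
    (hm : AdSSmoothOn J I Fm) (hK : MatSmoothOn J I K) (hs : s ∈ J) (ht : t ∈ I)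
    (hU : mds (toMat Fp) s t = toMat Fp s t * U) (hW : mds (toMat Fm) s t = toMat Fm s t * W)
    (hW0 : W.trace = 0) :
    mds (fun s t => sandwich (Fp s t) (Fm s t) (K s t)) s t =
      sandwich (Fp s t) (Fm s t) (U * K s t + mds K s t - K s t * W) := by
  simp only [sandwich, Matrix.SpecialLinearGroup.coe_inv]
  have h1 := mds_mul hJ hI (MatSmoothOn.mul (G := toMat Fp) hp hK)
    (MatSmoothOn.adjugate (G := toMat Fm) hm) hs ht
  have h2 := mds_mul (G := toMat Fp) hJ hI hp hK hs ht
  refine h1.trans ?_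
  rw [h2, mds_adjugate, hU, hW, Matrix.adjugate_mul_distrib, adjugate_eq_neg hW0]
  simp only [toMat]
  noncomm_ring

lemma mdt_sandwich (hJ : IsOpen J) (hI : IsOpen I) (hp : AdSSmoothOn J I Fp)
    (hm : AdSSmoothOn J I Fm) (hK : MatSmoothOn J I K) (hs : s ∈ J) (ht : t ∈ I)
    (hU : mdt (toMat Fp) s t = toMat Fp s t * U) (hW : mdt (toMat Fm) s t = toMat Fm s t * W)
    (hW0 : W.trace = 0) :
    mdt (fun s t => sandwich (Fp s t) (Fm s t) (K s t)) s t =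
      sandwich (Fp s t) (Fm s t) (U * K s t + mdt K s t - K s t * W) := by
  simp only [sandwich, Matrix.SpecialLinearGroup.coe_inv]
  have h1 := mdt_mul hJ hI (MatSmoothOn.mul (G := toMat Fp) hp hK)
    (MatSmoothOn.adjugate (G := toMat Fm) hm) hs ht
  have h2 := mdt_mul (G := toMat Fp) hJ hI hp hK hs ht
  refine h1.trans ?_
  rw [h2, mdt_adjugate, hU, hW, Matrix.adjugate_mul_distrib, adjugate_eq_neg hW0]
  simp only [toMat]
  noncomm_ring

end Derivatives

/-! ### Extended frames -/

/-- The matrix of the space part of the Lax pair of the KdV equation, with spectral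
parameter `m`. -/
def spaceLax (k m : ℝ) : Mat := !![0, k + m; 1, 0]

/-- The matrix of the time part of the Lax pair of the KdV equation, with spectral parameter `m`,
in terms of the potential `k` and its first two derivatives. -/
def timeLax (k k' k'' m : ℝ) : Mat :=
  !![-k', -k'' + (k + m) * (2 * k - 4 * m); 2 * k - 4 * m, k']

/-- `F` solves on `J × I` the Lax pair of the KdV equation with potential `κ` and spectral
parameter `m`. -/
structure IsExtendedFrame (J I : Set ℝ) (κ : ℝ → ℝ → ℝ) (m : ℝ) (F : ℝ → ℝ → AdS) : Prop where
  smooth : AdSSmoothOn J I F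
  space : ∀ s ∈ J, ∀ t ∈ I, mds (toMat F) s t = toMat F s t * spaceLax (κ s t) m
  time : ∀ s ∈ J, ∀ t ∈ I, mdt (toMat F) s t =
    toMat F s t * timeLax (κ s t) (pds κ s t) (pds (pds κ) s t) m

section Frames

variable {J I : Set ℝ} {κ : ℝ → ℝ → ℝ} {γ Fp Fm : ℝ → ℝ → AdS} {m : ℝ} {s t : ℝ}

lemma trace_spaceLax (k m : ℝ) : (spaceLax k m).trace = 0 := by
  simp [spaceLax, Matrix.trace_fin_two]

lemma trace_timeLax (k k' k'' m : ℝ) : (timeLax k k' k'' m).trace = 0 := by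
  simp [timeLax, Matrix.trace_fin_two]

lemma toMat_eq_sandwich (h : γ s t = Fp s t * (Fm s t)⁻¹) :
    toMat γ s t = sandwich (Fp s t) (Fm s t) 1 := by
  simp only [toMat, sandwich, h, Matrix.SpecialLinearGroup.coe_mul, mul_one]

/-- The first three derivatives of a null curve in terms of its spinor frame. -/
lemma mds_of_spinorFrame (hJ : IsOpen J) (hI : IsOpen I)
    (hp : AdSSmoothOn J I Fp) (hm : AdSSmoothOn J I Fm)
    (hps : ∀ s ∈ J, ∀ t ∈ I, mds (toMat Fp) s t = toMat Fp s t * spaceLax (κ s t) 1)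
    (hms : ∀ s ∈ J, ∀ t ∈ I, mds (toMat Fm) s t = toMat Fm s t * spaceLax (κ s t) (-1))
    (lift : ∀ s ∈ J, ∀ t ∈ I, γ s t = Fp s t * (Fm s t)⁻¹) :
    (∀ s ∈ J, ∀ t ∈ I,
      mds (toMat γ) s t = sandwich (Fp s t) (Fm s t) !![0, 2; 0, 0]) ∧
    (∀ s ∈ J, ∀ t ∈ I,
      mds (mds (toMat γ)) s t = sandwich (Fp s t) (Fm s t) !![-2, 0; 0, 2]) ∧
    (∀ s ∈ J, ∀ t ∈ I,
      mds (mds (mds (toMat γ))) s t =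
        sandwich (Fp s t) (Fm s t) !![0, 4 * κ s t; -4, 0]) := by
  have h0 : ∀ s ∈ J, ∀ t ∈ I, toMat γ s t = sandwich (Fp s t) (Fm s t) 1 :=
    fun s hs t ht => toMat_eq_sandwich (lift s hs t ht)
  -- Each derivative of a constant `K` replaces it by `U₊ K - K U₋`. The bending cancels in the
  -- first two steps and first appears in the third.
  have h1 : ∀ s ∈ J, ∀ t ∈ I,
      mds (toMat γ) s t = sandwich (Fp s t) (Fm s t) !![0, 2; 0, 0] := by
    intro s hs t ht
    rw [mds_congr hJ h0 hs ht, mds_sandwich hJ hI hp hm (matSmoothOn_const 1) hs ht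
      (hps s hs t ht) (hms s hs t ht) (trace_spaceLax _ _), mds_const]
    congr 1
    ext i j
    fin_cases i <;> fin_cases j <;> simp [spaceLax]; norm_num
  have h2 : ∀ s ∈ J, ∀ t ∈ I,
      mds (mds (toMat γ)) s t = sandwich (Fp s t) (Fm s t) !![-2, 0; 0, 2] := by
    intro s hs t ht
    rw [mds_congr hJ h1 hs ht, mds_sandwich hJ hI hp hm (matSmoothOn_const _) hs ht
      (hps s hs t ht) (hms s hs t ht) (trace_spaceLax _ _), mds_const]
    congr 1
    ext i j
    fin_cases i <;> fin_cases j <;> simp [spaceLax]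
  refine ⟨h1, h2, ?_⟩
  intro s hs t ht
  rw [mds_congr hJ h2 hs ht, mds_sandwich hJ hI hp hm (matSmoothOn_const _) hs ht
    (hps s hs t ht) (hms s hs t ht) (trace_spaceLax _ _), mds_const]
  congr 1
  ext i j
  fin_cases i <;> fin_cases j <;> simp [spaceLax] <;> ring

/-- The velocity of the LIEN flow in terms of the spinor frame. -/
def flowMatrix (k : ℝ) : Mat := !![0, -4 * k; -8, 0]

/-- The time derivative of `F₊ F₋⁻¹` is represented by the difference of the two time matrices;
`flow_sandwich` represents the right side of the LIEN flow by the same matrix. -/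
lemma timeLax_sub_timeLax (k k' k'' : ℝ) :
    timeLax k k' k'' 1 - timeLax k k' k'' (-1) = flowMatrix k := by
  ext i j
  fin_cases i <;> fin_cases j <;> simp [timeLax, flowMatrix] <;> ring

lemma flow_sandwich (A B : AdS) (k : ℝ) :
    (2 : ℝ) • sandwich A B !![0, 4 * k; -4, 0] - (6 * k) • sandwich A B !![0, 2; 0, 0] =
      sandwich A B (flowMatrix k) := by
  rw [← sandwich_smul, ← sandwich_smul, ← sandwich_sub]
  congr 1
  ext i j
  fin_cases i <;> fin_cases j <;> simp [flowMatrix] <;> ring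

/-- A pair of solutions of the Lax pair with spectral parameters `1` and `-1` gives rise to a
solution of the LIEN flow. -/
theorem isLIENSolution_of_isExtendedFrame (hJ : IsOpen J) (hI : IsOpen I)
    (hp : IsExtendedFrame J I κ 1 Fp) (hm : IsExtendedFrame J I κ (-1) Fm)
    (lift : ∀ s ∈ J, ∀ t ∈ I, γ s t = Fp s t * (Fm s t)⁻¹) :
    IsLIENSolution J I γ ∧ (∀ s ∈ J, ∀ t ∈ I, bending γ s t = κ s t) ∧
      IsSpinorFrame J I γ Fp Fm := by
  obtain ⟨h1, h2, h3⟩ := mds_of_spinorFrame hJ hI hp.smooth hm.smooth hp.space hm.space lift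
  have h0 : ∀ s ∈ J, ∀ t ∈ I, toMat γ s t = sandwich (Fp s t) (Fm s t) 1 :=
    fun s hs t ht => toMat_eq_sandwich (lift s hs t ht)
  have hb : ∀ s ∈ J, ∀ t ∈ I, bending γ s t = κ s t := by
    intro s hs t ht
    rw [bending, h3 s hs t ht, ip_sandwich, ip_fin_two]
    ring
  refine ⟨⟨⟨?_, ?_, ?_, ?_, ?_, ?_⟩, ?_⟩, hb, ⟨hp.smooth, hm.smooth, lift, ?_, ?_⟩⟩
  · exact (hp.smooth.sandwich hm.smooth (matSmoothOn_const 1)).congr h0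
  · intro s hs t ht h
    rw [h1 s hs t ht] at h
    have := congrFun (congrFun (sandwich_eq_zero _ _ h) 0) 1
    simp at this
  · intro s hs t ht
    rw [h1 s hs t ht, ip_sandwich, ip_fin_two]
    ring
  · intro s hs t ht
    rw [h1 s hs t ht, h0 s hs t ht]
    exact isPositiveBivector_sandwich _ _
  · intro s hs t ht
    rw [h1 s hs t ht, h2 s hs t ht]
    refine sandwich_linearIndependent _ _ ?_
    rw [LinearIndependent.pair_iff]
    intro a b hab
    have e0 := congrFun (congrFun hab 0) 0
    have e1 := congrFun (congrFun hab 0) 1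
    simp at e0 e1
    exact ⟨e1, e0⟩
  · intro s hs t ht
    rw [h2 s hs t ht, ip_sandwich, ip_fin_two]
    norm_num
  · intro s hs t ht
    rw [h1 s hs t ht, h3 s hs t ht, hb s hs t ht, flow_sandwich, mdt_congr hI h0 hs ht,
      mdt_sandwich hJ hI hp.smooth hm.smooth (matSmoothOn_const 1) hs ht (hp.time s hs t ht)
        (hm.time s hs t ht) (trace_timeLax _ _ _ _), mdt_const,
      ← timeLax_sub_timeLax _ (pds κ s t) (pds (pds κ) s t)]
    simp
  · intro s hs t ht
    rw [hb s hs t ht]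
    exact hp.space s hs t ht
  · intro s hs t ht
    rw [hb s hs t ht, sub_eq_add_neg]
    exact hm.space s hs t ht

/-! ### From a LIEN solution back to the Lax pair and KdV. -/

lemma bending_smooth (hJ : IsOpen J) (hI : IsOpen I) (hγ : AdSSmoothOn J I γ) :
    SmoothOn J I (bending γ) := by
  have h3 : MatSmoothOn J I (mds (mds (mds (toMat γ)))) :=
    MatSmoothOn.mds hJ hI (MatSmoothOn.mds hJ hI (MatSmoothOn.mds hJ hI hγ))
  unfold bending
  set G := mds (mds (mds (toMat γ))) with hG
  have h (s t : ℝ) : -(1 / 16) * ip (G s t) (G s t) =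
      1 / 16 * (G s t 0 0 * G s t 1 1 - G s t 0 1 * G s t 1 0) := by
    rw [Matrix.eta_fin_two (G s t), ip_fin_two]
    simp
    ring
  simp only [h]
  exact (smoothOn_const _).mul (((h3 0 0).mul (h3 1 1)).sub ((h3 0 1).mul (h3 1 0)))

/-- The logarithmic time derivative of a smooth map into `SL(2,ℝ)`. -/
def timeForm (F : ℝ → ℝ → AdS) (s t : ℝ) : Mat := (toMat F s t).adjugate * mdt (toMat F) s t

lemma mdt_eq_mul_timeForm (F : ℝ → ℝ → AdS) (s t : ℝ) :
    mdt (toMat F) s t = toMat F s t * timeForm F s t := by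
  rw [timeForm, ← mul_assoc, Matrix.mul_adjugate, toMat, Matrix.SpecialLinearGroup.det_coe,
    one_smul, one_mul]

lemma AdSSmoothOn.timeForm (hJ : IsOpen J) (hI : IsOpen I) {F : ℝ → ℝ → AdS}
    (hF : AdSSmoothOn J I F) : MatSmoothOn J I (timeForm F) :=
  (MatSmoothOn.adjugate (G := toMat F) hF).mul (MatSmoothOn.mdt (G := toMat F) hJ hI hF)

/-- This is the time derivative of `det F = 1`. -/
lemma trace_timeForm (hJ : IsOpen J) (hI : IsOpen I) {F : ℝ → ℝ → AdS} (hF : AdSSmoothOn J I F)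
    (hs : s ∈ J) (ht : t ∈ I) : (timeForm F s t).trace = 0 := by
  have hd : HasDerivAt
      (fun x => toMat F s x 0 0 * toMat F s x 1 1 - toMat F s x 0 1 * toMat F s x 1 0) _ t :=
    (((hF 0 0).hasDerivAt_pdt hJ hI hs ht).mul ((hF 1 1).hasDerivAt_pdt hJ hI hs ht)).sub
      (((hF 0 1).hasDerivAt_pdt hJ hI hs ht).mul ((hF 1 0).hasDerivAt_pdt hJ hI hs ht))
  have h1 : (fun x => toMat F s x 0 0 * toMat F s x 1 1 - toMat F s x 0 1 * toMat F s x 1 0) =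
      fun _ => (1 : ℝ) := by
    funext x
    rw [← Matrix.det_fin_two]
    exact (F s x).2
  rw [h1] at hd
  have h0 := hd.unique (hasDerivAt_const t (1 : ℝ))
  simp only [timeForm, Matrix.adjugate_fin_two, Matrix.trace_fin_two, Matrix.mul_apply,
    Fin.sum_univ_two, mdt, Matrix.of_apply, Matrix.cons_val]
  simp
  linarith

/-- The zero curvature equation. -/
lemma mds_timeForm (hJ : IsOpen J) (hI : IsOpen I) (hκ : SmoothOn J I κ) {F : ℝ → ℝ → AdS}
    (hF : AdSSmoothOn J I F)
    (hFs : ∀ s ∈ J, ∀ t ∈ I, mds (toMat F) s t = toMat F s t * spaceLax (κ s t) m)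
    (hs : s ∈ J) (ht : t ∈ I) :
    mds (timeForm F) s t = timeForm F s t * spaceLax (κ s t) m -
      spaceLax (κ s t) m * timeForm F s t + !![0, pdt κ s t; 0, 0] := by
  have hU : MatSmoothOn J I fun s t => spaceLax (κ s t) m :=
    matSmoothOn_of (smoothOn_const 0) (hκ.add (smoothOn_const m)) (smoothOn_const 1)
      (smoothOn_const 0)
  have hUt : mdt (fun s t => spaceLax (κ s t) m) s t = !![0, pdt κ s t; 0, 0] := by
    refine (mdt_of _ _ _ _ s t).trans ?_
    simp [pdt]
  -- Both mixed partials of `F` are expanded and equated; cancelling `F` on the left leaves the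
  -- curvature equation.
  have hc := MatSmoothOn.mds_mdt_comm (G := toMat F) hJ hI hF hs ht
  rw [mds_congr hJ (fun s _ t _ => mdt_eq_mul_timeForm F s t) hs ht,
    mdt_congr hI hFs hs ht, mds_mul (G := toMat F) hJ hI hF (hF.timeForm hJ hI) hs ht,
    mdt_mul (G := toMat F) hJ hI hF hU hs ht, hFs s hs t ht, mdt_eq_mul_timeForm, hUt] at hc
  refine coe_mul_left_cancel (F s t) ?_
  change toMat F s t * _ = toMat F s t * _
  rw [mul_add, mul_sub, ← mul_assoc, ← mul_assoc, eq_sub_of_add_eq' hc]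
  abel

/-- The spinor frame of a solution of the LIEN flow solves the Lax pair with potential the
bending, and the bending solves the KdV equation. -/
theorem IsLIENSolution.isExtendedFrame (hJ : IsOpen J) (hI : IsOpen I) (hγ : IsLIENSolution J I γ)
    (hF : IsSpinorFrame J I γ Fp Fm) :
    IsExtendedFrame J I (bending γ) 1 Fp ∧ IsExtendedFrame J I (bending γ) (-1) Fm ∧
      IsKdVSolution J I (bending γ) := by
  have hκ := bending_smooth hJ hI hγ.nullCurves.smooth
  set κ := bending γ with hκdef
  have hps : ∀ s ∈ J, ∀ t ∈ I, mds (toMat Fp) s t = toMat Fp s t * spaceLax (κ s t) 1 :=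
    hF.frenet_p
  have hms : ∀ s ∈ J, ∀ t ∈ I, mds (toMat Fm) s t = toMat Fm s t * spaceLax (κ s t) (-1) := by
    intro s hs t ht
    rw [hF.frenet_m s hs t ht, sub_eq_add_neg, spaceLax]
  obtain ⟨h1, h2, h3⟩ := mds_of_spinorFrame hJ hI hF.smooth_p hF.smooth_m hps hms hF.lift
  have h0 : ∀ s ∈ J, ∀ t ∈ I, toMat γ s t = sandwich (Fp s t) (Fm s t) 1 :=
    fun s hs t ht => toMat_eq_sandwich (hF.lift s hs t ht)
  -- The flow only fixes the difference of the two time forms. The zero curvature equations must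
  -- determine the forms themselves.
  have hV : ∀ s ∈ J, ∀ t ∈ I, timeForm Fp s t = timeForm Fm s t + flowMatrix (κ s t) := by
    intro s hs t ht
    have h := hγ.flow s hs t ht
    rw [h1 s hs t ht, h3 s hs t ht, flow_sandwich, mdt_congr hI h0 hs ht,
      mdt_sandwich hJ hI hF.smooth_p hF.smooth_m (matSmoothOn_const 1) hs ht
        (mdt_eq_mul_timeForm _ _ _) (mdt_eq_mul_timeForm _ _ _)
        (trace_timeForm hJ hI hF.smooth_m hs ht), mdt_const] at h
    have h' := sandwich_injective _ _ h
    rw [mul_one, one_mul, add_zero] at h'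
    exact sub_eq_iff_eq_add'.1 h'
  have hsm := hF.smooth_m.timeForm hJ hI
  have htr : ∀ s ∈ J, ∀ t ∈ I, timeForm Fm s t 1 1 = -timeForm Fm s t 0 0 := by
    intro s hs t ht
    have := trace_timeForm hJ hI hF.smooth_m hs ht
    rw [Matrix.trace_fin_two] at this
    linarith
  have hzm := fun s hs t ht => mds_timeForm (s := s) (t := t) hJ hI hκ hF.smooth_m hms hs ht
  have hzp := fun s hs t ht => mds_timeForm (s := s) (t := t) hJ hI hκ hF.smooth_p hps hs ht
  -- the entries of the zero curvature equations
  have hdiff : ∀ s ∈ J, ∀ t ∈ I, mds (timeForm Fp) s t =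
      mds (timeForm Fm) s t + !![0, -4 * pds κ s t; 0, 0] := by
    intro s hs t ht
    rw [mds_congr hJ hV hs ht]
    ext i j
    have hk : MatSmoothOn J I fun s t => flowMatrix (κ s t) :=
      matSmoothOn_of (smoothOn_const 0) ((smoothOn_const (-4)).mul hκ) (smoothOn_const (-8))
        (smoothOn_const 0)
    have hd := ((hsm i j).hasDerivAt_pds hJ hI hs ht).add ((hk i j).hasDerivAt_pds hJ hI hs ht)
    have hfm : mds (fun s t => flowMatrix (κ s t)) s t = !![0, -4 * pds κ s t; 0, 0] := by
      refine (mds_of _ _ _ _ s t).trans ?_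
      simp [pds]
    rw [← hfm]
    exact hd.deriv
  -- Subtracting the two curvature equations removes the derivatives of the unknown form and `∂ₜκ`.
  -- Two entries of the remaining algebraic system give the lower left and diagonal entries.
  have hc : ∀ s ∈ J, ∀ t ∈ I, timeForm Fm s t 1 0 = 2 * κ s t + 4 := by
    intro s hs t ht
    have h := hdiff s hs t ht
    rw [hzp s hs t ht, hzm s hs t ht, hV s hs t ht] at h
    have h := congrFun (congrFun h 0) 0
    simp [Matrix.mul_apply, Matrix.vecMul, dotProduct, Fin.sum_univ_two, spaceLax,
      flowMatrix] at h
    linarith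
  have ha : ∀ s ∈ J, ∀ t ∈ I, timeForm Fm s t 0 0 = -pds κ s t := by
    intro s hs t ht
    have h := hdiff s hs t ht
    rw [hzp s hs t ht, hzm s hs t ht, hV s hs t ht] at h
    have h := congrFun (congrFun h 0) 1
    simp [Matrix.mul_apply, Matrix.vecMul, dotProduct, Fin.sum_univ_two, spaceLax,
      flowMatrix, htr s hs t ht] at h
    linarith
  -- The last unknown entry comes from the diagonal of a single curvature equation, now that the
  -- diagonal entry of the form is known.
  have hb : ∀ s ∈ J, ∀ t ∈ I, timeForm Fm s t 0 1 =
      -pds (pds κ) s t + (κ s t + -1) * (2 * κ s t + 4) := by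
    intro s hs t ht
    have h := congrFun (congrFun (hzm s hs t ht) 0) 0
    have e : mds (timeForm Fm) s t 0 0 = -pds (pds κ) s t :=
      (pds_congr (g := fun s t => timeForm Fm s t 0 0) hJ ha hs ht).trans (by simp [pds])
    rw [e] at h
    simp [Matrix.mul_apply, Matrix.vecMul, dotProduct, Fin.sum_univ_two, spaceLax,
      hc s hs t ht] at h
    linarith
  have hVm : ∀ s ∈ J, ∀ t ∈ I,
      timeForm Fm s t = timeLax (κ s t) (pds κ s t) (pds (pds κ) s t) (-1) := by
    intro s hs t ht
    rw [Matrix.eta_fin_two (timeForm Fm s t), htr s hs t ht, ha s hs t ht, hb s hs t ht,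
      hc s hs t ht, timeLax]
    norm_num
  refine ⟨⟨hF.smooth_p, hps, ?_⟩, ⟨hF.smooth_m, hms, ?_⟩, hκ, ?_⟩
  · intro s hs t ht
    rw [mdt_eq_mul_timeForm, hV s hs t ht, hVm s hs t ht,
      ← timeLax_sub_timeLax (κ s t) (pds κ s t) (pds (pds κ) s t), add_sub_cancel]
  · intro s hs t ht
    rw [mdt_eq_mul_timeForm, hVm s hs t ht]
  · intro s hs t ht
    -- The upper right entry of the curvature equation has not been used for `Fm` alone; with the
    -- form known, it is KdV.
    have h := congrFun (congrFun (hzm s hs t ht) 0) 1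
    have hd0 := hκ.hasDerivAt_pds hJ hI hs ht
    have hd2 := (((hκ.pds hJ hI).pds hJ hI)).hasDerivAt_pds hJ hI hs ht
    have hd := hd2.neg.add ((hd0.add_const (-1)).mul ((hd0.const_mul 2).add_const 4))
    have e := (pds_congr (g := fun s t => timeForm Fm s t 0 1) hJ hb hs ht).trans hd.deriv
    have e' : mds (timeForm Fm) s t 0 1 = _ := e
    rw [e'] at h
    simp [Matrix.mul_apply, Matrix.vecMul, dotProduct, Fin.sum_univ_two, spaceLax,
      htr s hs t ht, ha s hs t ht] at h
    linarith

end Frames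

/-! ### Darboux transformations of extended frames -/

/-- The matrix of the Darboux transformation with transforming function `f` and parameter `l`, at
spectral parameter `m`. -/
def darboux (f l m : ℝ) : Mat := !![-f, m - l + f ^ 2; 1, -f]

/-- The normalized Darboux matrix. -/
def darbouxSL (a f l m : ℝ) (h : a ^ 2 * (l - m) = 1) : AdS :=
  ⟨a • darboux f l m, by
    rw [Matrix.det_smul, darboux, Matrix.det_fin_two_of, Fintype.card_fin]
    linear_combination h⟩

/-- The Darboux transform of the potential. -/
def darbouxPotential (κ f : ℝ → ℝ → ℝ) (l : ℝ) (s t : ℝ) : ℝ := 2 * f s t ^ 2 - κ s t - 2 * l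

section Darboux

variable {J I : Set ℝ} {κ κ' f f₁ f₂ : ℝ → ℝ → ℝ} {F : ℝ → ℝ → AdS} {a l l₁ l₂ m : ℝ} {s t : ℝ}

lemma IsWESolution.hasDerivAt_s (hf : IsWESolution J I κ l f) (hs : s ∈ J) (ht : t ∈ I) :
    HasDerivAt (fun x => f x t) (κ s t - f s t ^ 2 + l) s := by
  simpa using hasDerivAt_fst_of_hasFDerivAt (hf.equation s hs t ht)

lemma IsWESolution.hasDerivAt_t (hf : IsWESolution J I κ l f) (hs : s ∈ J) (ht : t ∈ I) :
    HasDerivAt (fun x => f s x) (4 * l * (f s t ^ 2 - l) - 2 * κ s t * (f s t ^ 2 + l)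
      + 2 * κ s t ^ 2 + 2 * f s t * LIEN.pds κ s t - LIEN.pds (LIEN.pds κ) s t) t := by
  simpa using hasDerivAt_snd_of_hasFDerivAt (hf.equation s hs t ht)

lemma IsWESolution.congr (hJ : IsOpen J) (hf : IsWESolution J I κ l f)
    (e : ∀ s ∈ J, ∀ t ∈ I, κ' s t = κ s t) : IsWESolution J I κ' l f := by
  refine ⟨hf.smooth, fun s hs t ht => ?_⟩
  rw [pds_congr hJ (fun s hs t ht => pds_congr hJ e hs ht) hs ht, pds_congr hJ e hs ht,
    e s hs t ht]
  exact hf.equation s hs t ht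

lemma IsKdVSolution.congr (hJ : IsOpen J) (hI : IsOpen I) (hκ : IsKdVSolution J I κ)
    (e : ∀ s ∈ J, ∀ t ∈ I, κ' s t = κ s t) : IsKdVSolution J I κ' := by
  refine ⟨hκ.smooth.congr e, fun s hs t ht => ?_⟩
  have e1 : ∀ s ∈ J, ∀ t ∈ I, pds κ' s t = pds κ s t := fun s hs t ht => pds_congr hJ e hs ht
  have e2 : ∀ s ∈ J, ∀ t ∈ I, pds (pds κ') s t = pds (pds κ) s t :=
    fun s hs t ht => pds_congr hJ e1 hs ht
  rw [pds_congr hJ e2 hs ht, e1 s hs t ht, e s hs t ht, pdt_congr hI e hs ht]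
  exact hκ.kdv s hs t ht

lemma pds_darbouxPotential (hJ : IsOpen J) (hI : IsOpen I) (hκ : SmoothOn J I κ)
    (hf : IsWESolution J I κ l f) (hs : s ∈ J) (ht : t ∈ I) :
    pds (darbouxPotential κ f l) s t = 4 * f s t * (κ s t - f s t ^ 2 + l) - pds κ s t := by
  have hd := ((((hf.hasDerivAt_s hs ht).pow 2).const_mul 2).sub
    (hκ.hasDerivAt_pds hJ hI hs ht)).sub_const (2 * l)
  refine hd.deriv.trans ?_
  simp
  ring

lemma pds_pds_darbouxPotential (hJ : IsOpen J) (hI : IsOpen I) (hκ : SmoothOn J I κ)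
    (hf : IsWESolution J I κ l f) (hs : s ∈ J) (ht : t ∈ I) :
    pds (pds (darbouxPotential κ f l)) s t = 4 * (κ s t - f s t ^ 2 + l) ^ 2 +
      4 * f s t * (pds κ s t - 2 * f s t * (κ s t - f s t ^ 2 + l)) - pds (pds κ) s t := by
  rw [pds_congr hJ (fun s hs t ht => pds_darbouxPotential hJ hI hκ hf hs ht) hs ht]
  have hfs := hf.hasDerivAt_s hs ht
  have hd := ((hfs.const_mul 4).mul
    (((hκ.hasDerivAt_pds hJ hI hs ht).sub (hfs.pow 2)).add_const l)).sub
    ((hκ.pds hJ hI).hasDerivAt_pds hJ hI hs ht)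
  refine hd.deriv.trans ?_
  simp
  ring

/-- A Darboux transformation takes an extended frame to an extended frame. -/
theorem IsExtendedFrame.darboux (hJ : IsOpen J) (hI : IsOpen I) (hκ : SmoothOn J I κ)
    (hF : IsExtendedFrame J I κ m F) (hf : IsWESolution J I κ l f)
    (h : a ^ 2 * (l - m) = 1) :
    IsExtendedFrame J I (darbouxPotential κ f l) m
      fun s t => F s t * darbouxSL a (f s t) l m h := by
  have hD : MatSmoothOn J I fun s t => LIEN.darboux (f s t) l m :=
    matSmoothOn_of hf.smooth.neg ((smoothOn_const (m - l)).add (hf.smooth.pow 2))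
      (smoothOn_const 1) hf.smooth.neg
  have hG : (toMat fun s t => F s t * darbouxSL a (f s t) l m h) =
      fun s t => a • (toMat F s t * LIEN.darboux (f s t) l m) := by
    funext s t
    exact Matrix.mul_smul _ _ _
  refine ⟨?_, ?_, ?_⟩
  · change MatSmoothOn J I (toMat fun s t => F s t * darbouxSL a (f s t) l m h)
    rw [hG]
    exact (MatSmoothOn.mul (G := toMat F) hF.smooth hD).smul a
  · intro s hs t ht
    have hfs := hf.hasDerivAt_s hs ht
    have hDs : mds (fun s t => LIEN.darboux (f s t) l m) s t =
        !![-(κ s t - f s t ^ 2 + l), 2 * f s t * (κ s t - f s t ^ 2 + l);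
          0, -(κ s t - f s t ^ 2 + l)] := by
      refine (mds_of _ _ _ _ s t).trans ?_
      have e1 : pds (fun s t => -f s t) s t = -(κ s t - f s t ^ 2 + l) := hfs.neg.deriv
      have e2 : pds (fun s t => m - l + f s t ^ 2) s t =
          2 * f s t * (κ s t - f s t ^ 2 + l) := by
        refine ((hfs.pow 2).const_add (m - l)).deriv.trans ?_
        simp
      have e3 : pds (fun _ _ => 1) s t = 0 := by simp [pds]
      rw [e1, e2, e3]
    rw [hG, mds_smul, mds_mul (G := toMat F) hJ hI hF.smooth hD hs ht, hF.space s hs t ht, hDs,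
      smul_mul_assoc, mul_assoc (toMat F s t), mul_assoc (toMat F s t), ← mul_add]
    -- What remains is the gauge identity `U D + ∂ₛD = D U'`, where the Wahlquist–Estabrook equation
    -- has already eliminated `∂ₛf`.
    congr 2
    ext i j
    fin_cases i <;> fin_cases j <;>
      simp [LIEN.darboux, spaceLax, darbouxPotential] <;> ring
  · intro s hs t ht
    have hft := hf.hasDerivAt_t hs ht
    set ft := 4 * l * (f s t ^ 2 - l) - 2 * κ s t * (f s t ^ 2 + l)
      + 2 * κ s t ^ 2 + 2 * f s t * LIEN.pds κ s t - LIEN.pds (LIEN.pds κ) s t with hftdef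
    have hDt : mdt (fun s t => LIEN.darboux (f s t) l m) s t =
        !![-ft, 2 * f s t * ft; 0, -ft] := by
      refine (mdt_of _ _ _ _ s t).trans ?_
      have e1 : pdt (fun s t => -f s t) s t = -ft := hft.neg.deriv
      have e2 : pdt (fun s t => m - l + f s t ^ 2) s t = 2 * f s t * ft := by
        refine ((hft.pow 2).const_add (m - l)).deriv.trans ?_
        simp
      have e3 : pdt (fun _ _ => 1) s t = 0 := by simp [pdt]
      rw [e1, e2, e3]
    rw [hG, mdt_smul, mdt_mul (G := toMat F) hJ hI hF.smooth hD hs ht, hF.time s hs t ht, hDt,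
      smul_mul_assoc, mul_assoc (toMat F s t), mul_assoc (toMat F s t), ← mul_add,
      pds_darbouxPotential hJ hI hκ hf hs ht,
      pds_pds_darbouxPotential hJ hI hκ hf hs ht, hftdef]
    -- The time analogue is also polynomial in `f`, `κ`, `∂ₛκ` and `∂ₛ²κ`; KdV for `κ` is not
    -- needed.
    congr 2
    ext i j
    fin_cases i <;> fin_cases j <;>
      simp [LIEN.darboux, timeLax, darbouxPotential] <;> ring

/-- The superposition formula for solutions of the Wahlquist–Estabrook equation. -/
theorem IsWESolution.superposition (hJ : IsOpen J) (hI : IsOpen I) (hκ : SmoothOn J I κ)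
    (hf₁ : IsWESolution J I κ l₁ f₁) (hf₂ : IsWESolution J I κ l₂ f₂)
    (hne : ∀ s ∈ J, ∀ t ∈ I, f₁ s t ≠ f₂ s t) :
    IsWESolution J I (darbouxPotential κ f₁ l₁) l₂
      fun s t => -f₁ s t + (l₁ - l₂) / (f₁ s t - f₂ s t) := by
  refine ⟨hf₁.smooth.neg.add ((smoothOn_const _).div (hf₁.smooth.sub hf₂.smooth)
    fun s hs t ht => sub_ne_zero.2 (hne s hs t ht)), fun s hs t ht => ?_⟩
  have h0 : f₁ s t - f₂ s t ≠ 0 := sub_ne_zero.2 (hne s hs t ht)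
  have hd := (hf₁.equation s hs t ht).fun_neg.fun_add
    (((hasDerivAt_inv h0).const_mul (l₁ - l₂)).comp_hasFDerivAt (s, t)
      (f := fun p : ℝ × ℝ => f₁ p.1 p.2 - f₂ p.1 p.2)
      ((hf₁.equation s hs t ht).fun_sub (hf₂.equation s hs t ht)))
  rw [pds_darbouxPotential hJ hI hκ hf₁ hs ht, pds_pds_darbouxPotential hJ hI hκ hf₁ hs ht]
  refine hd.congr_fderiv ?_
  -- The `ds` and `dt` components are rational identities in `f₁`, `f₂`, `κ` and the first two
  -- `s`-derivatives of `κ`.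
  ext
  · simp [darbouxPotential]
    field_simp
    ring
  · simp [darbouxPotential]
    field_simp
    ring

/-- Permutability of Darboux matrices. -/
lemma darboux_mul_darboux_comm {y₁ y₂ : ℝ} (hne : y₁ ≠ y₂) (l₁ l₂ m : ℝ) :
    darboux y₁ l₁ m * darboux (-y₁ + (l₁ - l₂) / (y₁ - y₂)) l₂ m =
      darboux y₂ l₂ m * darboux (-y₂ + (l₁ - l₂) / (y₁ - y₂)) l₁ m := by
  have h0 : y₁ - y₂ ≠ 0 := sub_ne_zero.2 hne
  simp only [darboux, Matrix.mul_fin_two]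
  ext i j
  fin_cases i <;> fin_cases j <;> simp <;> field_simp <;> ring

/-- The normalizing factors, signs included, are scalars attached to `l₁` and `l₂`, so both orders
carry the same product of factors. -/
lemma darbouxSL_mul_darbouxSL_comm {y₁ y₂ a₁ a₂ : ℝ} (hne : y₁ ≠ y₂)
    (h₁ : a₁ ^ 2 * (l₁ - m) = 1) (h₂ : a₂ ^ 2 * (l₂ - m) = 1) :
    darbouxSL a₁ y₁ l₁ m h₁ * darbouxSL a₂ (-y₁ + (l₁ - l₂) / (y₁ - y₂)) l₂ m h₂ =
      darbouxSL a₂ y₂ l₂ m h₂ * darbouxSL a₁ (-y₂ + (l₁ - l₂) / (y₁ - y₂)) l₁ m h₁ := by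
  apply Subtype.ext
  change a₁ • darboux y₁ l₁ m * a₂ • darboux _ l₂ m = a₂ • darboux y₂ l₂ m * a₁ • darboux _ l₁ m
  rw [smul_mul_smul_comm, smul_mul_smul_comm, darboux_mul_darboux_comm hne, mul_comm a₁]

end Darboux

/-! ### `𝒯`-transforms as Darboux transformations -/

/-- The normalizing factor of the Darboux matrix at spectral parameter `1`, with the sign `ε`. -/
def plusFactor (ε : ℤˣ) (ξ : ℝ) : ℝ := ((ε : ℤ) : ℝ) / (√2 * Real.sinh ξ)

/-- The normalizing factor of the Darboux matrix at spectral parameter `-1`. -/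
def minusFactor (ξ : ℝ) : ℝ := 1 / (√2 * Real.cosh ξ)

lemma sq_units_cast (ε : ℤˣ) : ((ε : ℤ) : ℝ) ^ 2 = 1 := by
  rcases Int.units_eq_one_or ε with h | h <;> simp [h]

/-- The Darboux matrix has determinant `l - m`, here `cosh 2ξ - 1 = 2 sinh² ξ`. At `m = -1` it is `2
cosh² ξ`. -/
lemma plusFactor_sq (ε : ℤˣ) {ξ : ℝ} (hξ : ξ ≠ 0) :
    plusFactor ε ξ ^ 2 * (Real.cosh (2 * ξ) - 1) = 1 := by
  have h0 : Real.sinh ξ ≠ 0 := Real.sinh_ne_zero.2 hξ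
  have h2 : √(2 : ℝ) ^ 2 = 2 := Real.sq_sqrt (by norm_num)
  rw [plusFactor, div_pow, mul_pow, sq_units_cast, h2, Real.cosh_two_mul, Real.cosh_sq]
  field_simp
  ring

lemma minusFactor_sq (ξ : ℝ) : minusFactor ξ ^ 2 * (Real.cosh (2 * ξ) - -1) = 1 := by
  have h0 : Real.cosh ξ ≠ 0 := (Real.cosh_pos ξ).ne'
  have h2 : √(2 : ℝ) ^ 2 = 2 := Real.sq_sqrt (by norm_num)
  rw [minusFactor, div_pow, mul_pow, h2, Real.cosh_two_mul, Real.sinh_sq]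
  field_simp
  ring

/-- The first spinor frame of a `𝒯`-transform. -/
def plusFrame (ε : ℤˣ) {ξ : ℝ} (hξ : ξ ≠ 0) (f : ℝ → ℝ → ℝ) (F : ℝ → ℝ → AdS) (s t : ℝ) : AdS :=
  F s t * darbouxSL (plusFactor ε ξ) (f s t) (Real.cosh (2 * ξ)) 1 (plusFactor_sq ε hξ)

/-- The second spinor frame of a `𝒯`-transform. -/
def minusFrame (ξ : ℝ) (f : ℝ → ℝ → ℝ) (F : ℝ → ℝ → AdS) (s t : ℝ) : AdS :=
  F s t * darbouxSL (minusFactor ξ) (f s t) (Real.cosh (2 * ξ)) (-1) (minusFactor_sq ξ)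

/-- In `D₊ adj(D₋)` the quadratic terms in `y` cancel on the diagonal and the cubic ones off it,
leaving an upper triangular matrix affine in `y`. This identifies `𝒯`-transforms with Darboux
transformations. -/
lemma sandwich_darbouxSL (ε : ℤˣ) {ξ : ℝ} (hξ : ξ ≠ 0) (y : ℝ) :
    sandwich (darbouxSL (plusFactor ε ξ) y (Real.cosh (2 * ξ)) 1 (plusFactor_sq ε hξ))
      (darbouxSL (minusFactor ξ) y (Real.cosh (2 * ξ)) (-1) (minusFactor_sq ξ)) 1 =
      (ε : ℤ) • transformMatrix ξ y := by
  have h0 : Real.sinh ξ ≠ 0 := Real.sinh_ne_zero.2 hξ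
  have h0' : Real.cosh ξ ≠ 0 := (Real.cosh_pos ξ).ne'
  have hr : √(2 : ℝ) ≠ 0 := by positivity
  have h2 : √(2 : ℝ) ^ 2 = 2 := Real.sq_sqrt (by norm_num)
  have hc : Real.cosh (2 * ξ) = Real.cosh ξ ^ 2 + Real.sinh ξ ^ 2 := Real.cosh_two_mul ξ
  have h1 : Real.cosh ξ ^ 2 = Real.sinh ξ ^ 2 + 1 := Real.cosh_sq ξ
  have hprod : plusFactor ε ξ * minusFactor ξ * (2 * Real.sinh ξ * Real.cosh ξ) = (ε : ℤ) := by
    rw [plusFactor, minusFactor]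
    field_simp
    rw [h2]
  have hD : sandwich (darbouxSL (plusFactor ε ξ) y (Real.cosh (2 * ξ)) 1 (plusFactor_sq ε hξ))
      (darbouxSL (minusFactor ξ) y (Real.cosh (2 * ξ)) (-1) (minusFactor_sq ξ)) 1 =
      (plusFactor ε ξ * minusFactor ξ) •
        !![2 * Real.sinh ξ ^ 2, -(2 * y); 0, 2 * Real.cosh ξ ^ 2] := by
    rw [sandwich, mul_one, Matrix.SpecialLinearGroup.coe_inv]
    change plusFactor ε ξ • darboux y _ _ * (minusFactor ξ • darboux y _ _).adjugate = _
    rw [Matrix.adjugate_smul, Fintype.card_fin, pow_one, smul_mul_smul_comm]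
    congr 1
    rw [darboux, darboux, Matrix.adjugate_fin_two_of, Matrix.mul_fin_two, hc, h1]
    ext i j
    fin_cases i <;> fin_cases j <;> simp <;> ring
  have hT : transformMatrix ξ y = (2 * Real.sinh ξ * Real.cosh ξ)⁻¹ •
      !![2 * Real.sinh ξ ^ 2, -(2 * y); 0, 2 * Real.cosh ξ ^ 2] := by
    rw [transformMatrix, Real.tanh_eq_sinh_div_cosh]
    ext i j
    fin_cases i <;> fin_cases j <;> simp <;> field_simp
  rw [hD, hT, ← Int.cast_smul_eq_zsmul ℝ, ← hprod, smul_smul, mul_assoc,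
    mul_inv_cancel₀ (by positivity), mul_one]

section Transforms

variable {J I : Set ℝ} {f f₁ f₂ : ℝ → ℝ → ℝ} {γ γ' Fp Fm Fp' Fm' : ℝ → ℝ → AdS} {ε : ℤˣ} {ξ : ℝ}
  {s t : ℝ}

/-- The action on matrices of a spinor frame along a null curve only depends on the curve. -/
lemma IsSpinorFrame.sandwich_eq (hJ : IsOpen J) (hI : IsOpen I)
    (hF : IsSpinorFrame J I γ Fp Fm) (hF' : IsSpinorFrame J I γ Fp' Fm')
    (hs : s ∈ J) (ht : t ∈ I) (K : Mat) :
    sandwich (Fp' s t) (Fm' s t) K = sandwich (Fp s t) (Fm s t) K := by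
  have hd {Gp Gm : ℝ → ℝ → AdS} (hG : IsSpinorFrame J I γ Gp Gm) :=
    mds_of_spinorFrame (κ := bending γ) hJ hI hG.smooth_p hG.smooth_m hG.frenet_p
      (fun s hs t ht => by rw [hG.frenet_m s hs t ht, sub_eq_add_neg, spaceLax]) hG.lift
  obtain ⟨h1, h2, h3⟩ := hd hF
  obtain ⟨h1', h2', h3'⟩ := hd hF'
  have e0 := (toMat_eq_sandwich (hF'.lift s hs t ht)).symm.trans
    (toMat_eq_sandwich (hF.lift s hs t ht))
  have e1 := (h1' s hs t ht).symm.trans (h1 s hs t ht)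
  have e2 := (h2' s hs t ht).symm.trans (h2 s hs t ht)
  have e3 := (h3' s hs t ht).symm.trans (h3 s hs t ht)
  -- The matrices representing the curve and its first three derivatives span `Mat`, so the curve
  -- fixes the action on every `K`. This replaces uniqueness of the frame up to a common sign.
  have hK : K = ((K 0 0 + K 1 1) / 2) • (1 : Mat) +
      ((K 0 1 + K 1 0 * bending γ s t) / 2) • !![0, 2; 0, 0] +
      ((K 1 1 - K 0 0) / 4) • !![-2, 0; 0, 2] +
      (-K 1 0 / 4) • !![0, 4 * bending γ s t; -4, 0] := by
    ext i j
    fin_cases i <;> fin_cases j <;> simp <;> ring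
  rw [hK]
  simp only [sandwich_add, sandwich_smul, e0, e1, e2, e3]

/-- The frame in the definition of a transform is only asserted to exist; this allows any chosen
frame to be used instead. -/
lemma IsTTransform.toMat_eq (hJ : IsOpen J) (hI : IsOpen I) (h : IsTTransform J I ε ξ f γ γ')
    (hF : IsSpinorFrame J I γ Fp Fm) (hs : s ∈ J) (ht : t ∈ I) :
    toMat γ' s t = (ε : ℤ) • sandwich (Fp s t) (Fm s t) (transformMatrix ξ (f s t)) := by
  obtain ⟨Fp', Fm', hF', h'⟩ := h.transform
  rw [h' s hs t ht, ← hF.sandwich_eq hJ hI hF' hs ht]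
  rfl

lemma toMat_plusFrame_mul_inv (hξ : ξ ≠ 0) (s t : ℝ) :
    ((plusFrame ε hξ f Fp s t * (minusFrame ξ f Fm s t)⁻¹ : AdS) : Mat) =
      (ε : ℤ) • sandwich (Fp s t) (Fm s t) (transformMatrix ξ (f s t)) := by
  have hz : (ε : ℤ) • sandwich (Fp s t) (Fm s t) (transformMatrix ξ (f s t)) =
      sandwich (Fp s t) (Fm s t) ((ε : ℤ) • transformMatrix ξ (f s t)) := by
    rw [← Int.cast_smul_eq_zsmul ℝ, ← Int.cast_smul_eq_zsmul ℝ, sandwich_smul]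
  rw [hz, ← sandwich_darbouxSL ε hξ, plusFrame, minusFrame, mul_inv_rev]
  simp only [sandwich, Matrix.SpecialLinearGroup.coe_mul, mul_one, mul_assoc]

lemma IsTTransform.eq_plusFrame_mul_inv (hJ : IsOpen J) (hI : IsOpen I)
    (h : IsTTransform J I ε ξ f γ γ') (hF : IsSpinorFrame J I γ Fp Fm) (hs : s ∈ J) (ht : t ∈ I) :
    γ' s t = plusFrame ε h.parameter_ne_zero f Fp s t * (minusFrame ξ f Fm s t)⁻¹ :=
  Subtype.ext ((h.toMat_eq hJ hI hF hs ht).trans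
    (toMat_plusFrame_mul_inv h.parameter_ne_zero s t).symm)

/-- `𝒯`-transforms exist along null curves with a spinor frame. -/
lemma exists_isTTransform (ε : ℤˣ) (hξ : ξ ≠ 0) (hF : IsSpinorFrame J I γ Fp Fm)
    (hf : IsWESolution J I (bending γ) (Real.cosh (2 * ξ)) f) :
    ∃ γ', IsTTransform J I ε ξ f γ γ' :=
  ⟨fun s t => plusFrame ε hξ f Fp s t * (minusFrame ξ f Fm s t)⁻¹, hξ, hf, Fp, Fm, hF,
    fun s _ t _ => toMat_plusFrame_mul_inv hξ s t⟩

/-- A `𝒯`-transform of a solution of the LIEN flow is a solution of the LIEN flow. -/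
theorem IsTTransform.isLIENSolution (hJ : IsOpen J) (hI : IsOpen I) (hγ : IsLIENSolution J I γ)
    (h : IsTTransform J I ε ξ f γ γ') (hF : IsSpinorFrame J I γ Fp Fm) :
    IsLIENSolution J I γ' ∧
      (∀ s ∈ J, ∀ t ∈ I,
        bending γ' s t = darbouxPotential (bending γ) f (Real.cosh (2 * ξ)) s t) ∧
      IsSpinorFrame J I γ' (plusFrame ε h.parameter_ne_zero f Fp) (minusFrame ξ f Fm) := by
  have hκ := bending_smooth hJ hI hγ.nullCurves.smooth
  obtain ⟨hp, hm, -⟩ := hγ.isExtendedFrame hJ hI hF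
  exact isLIENSolution_of_isExtendedFrame hJ hI
    (hp.darboux hJ hI hκ h.wahlquistEstabrook (plusFactor_sq ε h.parameter_ne_zero))
    (hm.darboux hJ hI hκ h.wahlquistEstabrook (minusFactor_sq ξ))
    fun s hs t ht => h.eq_plusFrame_mul_inv hJ hI hF hs ht

/-! ### Exchange symmetry and composite transforms. -/

lemma quotientTerm_swap (ξ₁ ξ₂ : ℝ) (f₁ f₂ : ℝ → ℝ → ℝ) (s t : ℝ) :
    quotientTerm ξ₁ ξ₂ f₁ f₂ s t = quotientTerm ξ₂ ξ₁ f₂ f₁ s t := by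
  rw [quotientTerm, quotientTerm, ← neg_sub (Real.cosh (2 * ξ₂)), ← neg_sub (f₂ s t),
    neg_div_neg_eq]

/-- By this symmetry, results about composites need proof for one order only. -/
lemma f12_eq_f21 (ξ₁ ξ₂ : ℝ) (f₁ f₂ : ℝ → ℝ → ℝ) : f12 ξ₁ ξ₂ f₁ f₂ = f21 ξ₂ ξ₁ f₂ f₁ := by
  funext s t
  rw [f12, f21, quotientTerm_swap]

lemma kappa21_swap (κ : ℝ → ℝ → ℝ) (ξ₁ ξ₂ : ℝ) (f₁ f₂ : ℝ → ℝ → ℝ) (s t : ℝ) :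
    kappa21 κ ξ₁ ξ₂ f₁ f₂ s t = kappa21 κ ξ₂ ξ₁ f₂ f₁ s t := by
  rw [kappa21, kappa21, quotientTerm_swap, ← neg_sub (f₂ s t), div_neg, add_comm (f₁ s t)]
  ring

/-- With `q` the quotient term, the `f₁²` terms cancel and `λ₁ - λ₂ = q (f₁ - f₂)` turns `-4 f₁ q +
2 (λ₁ - λ₂)` into `-2 q (f₁ + f₂)`. -/
lemma darbouxPotential_darbouxPotential (κ : ℝ → ℝ → ℝ) (ξ₁ ξ₂ : ℝ) (hne : f₁ s t ≠ f₂ s t) :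
    darbouxPotential (darbouxPotential κ f₁ (Real.cosh (2 * ξ₁))) (f21 ξ₁ ξ₂ f₁ f₂)
      (Real.cosh (2 * ξ₂)) s t = kappa21 κ ξ₁ ξ₂ f₁ f₂ s t := by
  have h0 : f₁ s t - f₂ s t ≠ 0 := sub_ne_zero.2 hne
  simp only [darbouxPotential, f21, kappa21, quotientTerm]
  field_simp
  ring

lemma plusFrame_plusFrame {ε₁ ε₂ : ℤˣ} {ξ₁ ξ₂ : ℝ} (h₁ : ξ₁ ≠ 0) (h₂ : ξ₂ ≠ 0)
    (hne : f₁ s t ≠ f₂ s t) :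
    plusFrame ε₂ h₂ (f21 ξ₁ ξ₂ f₁ f₂) (plusFrame ε₁ h₁ f₁ Fp) s t =
      plusFrame ε₁ h₁ (f12 ξ₁ ξ₂ f₁ f₂) (plusFrame ε₂ h₂ f₂ Fp) s t := by
  simp only [plusFrame, f21, f12, quotientTerm, mul_assoc]
  rw [darbouxSL_mul_darbouxSL_comm hne]

lemma minusFrame_minusFrame {ξ₁ ξ₂ : ℝ} (hne : f₁ s t ≠ f₂ s t) :
    minusFrame ξ₂ (f21 ξ₁ ξ₂ f₁ f₂) (minusFrame ξ₁ f₁ Fm) s t =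
      minusFrame ξ₁ (f12 ξ₁ ξ₂ f₁ f₂) (minusFrame ξ₂ f₂ Fm) s t := by
  simp only [minusFrame, f21, f12, quotientTerm, mul_assoc]
  rw [darbouxSL_mul_darbouxSL_comm hne]

lemma IsTTransform.isWESolution_f21 (hJ : IsOpen J) (hI : IsOpen I) {γ₁ : ℝ → ℝ → AdS}
    {ξ₁ ξ₂ : ℝ} (hγ : IsLIENSolution J I γ) (h₁ : IsTTransform J I ε ξ₁ f₁ γ γ₁)
    (h₂ : IsWESolution J I (bending γ) (Real.cosh (2 * ξ₂)) f₂)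
    (hne : ∀ s ∈ J, ∀ t ∈ I, f₁ s t ≠ f₂ s t) :
    IsWESolution J I (bending γ₁) (Real.cosh (2 * ξ₂)) (f21 ξ₁ ξ₂ f₁ f₂) := by
  obtain ⟨Fp, Fm, hF, -⟩ := h₁.transform
  exact (h₁.wahlquistEstabrook.superposition hJ hI
    (bending_smooth hJ hI hγ.nullCurves.smooth) h₂ hne).congr hJ
    (h₁.isLIENSolution hJ hI hγ hF).2.1

/-- The second of two successive `𝒯`-transforms is a solution of the LIEN flow with bending
`kappa21`. -/
lemma IsTTransform.isLIENSolution_f21 (hJ : IsOpen J) (hI : IsOpen I) {γ₁ γ₂₁ : ℝ → ℝ → AdS}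
    {ε₁ ε₂ : ℤˣ} {ξ₁ ξ₂ : ℝ} (hγ : IsLIENSolution J I γ) (h₁ : IsTTransform J I ε₁ ξ₁ f₁ γ γ₁)
    (h₂₁ : IsTTransform J I ε₂ ξ₂ (f21 ξ₁ ξ₂ f₁ f₂) γ₁ γ₂₁)
    (hne : ∀ s ∈ J, ∀ t ∈ I, f₁ s t ≠ f₂ s t) :
    IsLIENSolution J I γ₂₁ ∧
      (∀ s ∈ J, ∀ t ∈ I, bending γ₂₁ s t = kappa21 (bending γ) ξ₁ ξ₂ f₁ f₂ s t) ∧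
      IsKdVSolution J I (kappa21 (bending γ) ξ₁ ξ₂ f₁ f₂) := by
  obtain ⟨Fp, Fm, hF, -⟩ := h₁.transform
  obtain ⟨hγ₁, hb₁, hF₁⟩ := h₁.isLIENSolution hJ hI hγ hF
  obtain ⟨hγ₂₁, hb₂₁, hF₂₁⟩ := h₂₁.isLIENSolution hJ hI hγ₁ hF₁
  have hb : ∀ s ∈ J, ∀ t ∈ I, bending γ₂₁ s t = kappa21 (bending γ) ξ₁ ξ₂ f₁ f₂ s t := by
    intro s hs t ht
    rw [hb₂₁ s hs t ht, ← darbouxPotential_darbouxPotential _ _ _ (hne s hs t ht),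
      darbouxPotential, hb₁ s hs t ht]
    rfl
  exact ⟨hγ₂₁, hb, (hγ₂₁.isExtendedFrame hJ hI hF₂₁).2.2.congr hJ hI
    fun s hs t ht => (hb s hs t ht).symm⟩

end Transforms

end LIEN

end

theorem theorem4p5 (J I : Set ℝ) (hJ : IsOpen J) (hJ' : J.OrdConnected)
    (hI : IsOpen I) (hI' : I.OrdConnected)
    (γ γ₁ γ₂ : ℝ → ℝ → LIEN.AdS) (ξ₁ ξ₂ : ℝ) (f₁ f₂ : ℝ → ℝ → ℝ) (ε₁ ε₂ : ℤˣ)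
    (hγ : LIEN.IsLIENSolution J I γ)
    (h₁ : LIEN.IsTTransform J I ε₁ ξ₁ f₁ γ γ₁)
    (h₂ : LIEN.IsTTransform J I ε₂ ξ₂ f₂ γ γ₂)
    (hξ : ξ₁ ≠ ξ₂)
    (hf : ∀ s ∈ J, ∀ t ∈ I, f₁ s t ≠ f₂ s t) :
    -- the two transforms are again solutions of the LIEN flow
    LIEN.IsLIENSolution J I γ₁ ∧ LIEN.IsLIENSolution J I γ₂ ∧
    -- the Wahlquist–Estabrook equations
    LIEN.IsWESolution J I (LIEN.bending γ₁) (Real.cosh (2 * ξ₂)) (LIEN.f21 ξ₁ ξ₂ f₁ f₂) ∧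
    LIEN.IsWESolution J I (LIEN.bending γ₂) (Real.cosh (2 * ξ₁)) (LIEN.f12 ξ₁ ξ₂ f₁ f₂) ∧
    -- both composite transforms exist
    (∃ γ₂₁, LIEN.IsTTransform J I ε₂ ξ₂ (LIEN.f21 ξ₁ ξ₂ f₁ f₂) γ₁ γ₂₁) ∧
    (∃ γ₁₂, LIEN.IsTTransform J I ε₁ ξ₁ (LIEN.f12 ξ₁ ξ₂ f₁ f₂) γ₂ γ₁₂) ∧
    -- they coincide, solve the LIEN flow, and have bending `κ_{2→1}`
    (∀ γ₂₁ γ₁₂, LIEN.IsTTransform J I ε₂ ξ₂ (LIEN.f21 ξ₁ ξ₂ f₁ f₂) γ₁ γ₂₁ →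
      LIEN.IsTTransform J I ε₁ ξ₁ (LIEN.f12 ξ₁ ξ₂ f₁ f₂) γ₂ γ₁₂ →
      (∀ s ∈ J, ∀ t ∈ I, γ₂₁ s t = γ₁₂ s t) ∧
      LIEN.IsLIENSolution J I γ₂₁ ∧ LIEN.IsLIENSolution J I γ₁₂ ∧
      (∀ s ∈ J, ∀ t ∈ I,
        LIEN.bending γ₂₁ s t = LIEN.kappa21 (LIEN.bending γ) ξ₁ ξ₂ f₁ f₂ s t) ∧
      (∀ s ∈ J, ∀ t ∈ I,
        LIEN.bending γ₁₂ s t = LIEN.kappa21 (LIEN.bending γ) ξ₁ ξ₂ f₁ f₂ s t)) ∧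
    -- `κ_{2→1}` solves KdV
    LIEN.IsKdVSolution J I (LIEN.kappa21 (LIEN.bending γ) ξ₁ ξ₂ f₁ f₂) := by
  -- One frame along `γ` serves both transforms, so the composite frames can be compared directly.
  obtain ⟨Fp, Fm, hF, -⟩ := h₁.transform
  have hf' : ∀ s ∈ J, ∀ t ∈ I, f₂ s t ≠ f₁ s t := fun s hs t ht => (hf s hs t ht).symm
  obtain ⟨hγ₁, -, hF₁⟩ := h₁.isLIENSolution hJ hI hγ hF
  obtain ⟨hγ₂, -, hF₂⟩ := h₂.isLIENSolution hJ hI hγ hF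
  have hw₁ := h₁.isWESolution_f21 hJ hI hγ h₂.wahlquistEstabrook hf
  have hw₂ := h₂.isWESolution_f21 hJ hI hγ h₁.wahlquistEstabrook hf'
  rw [← LIEN.f12_eq_f21] at hw₂
  have hex := LIEN.exists_isTTransform ε₂ h₂.parameter_ne_zero hF₁ hw₁
  refine ⟨hγ₁, hγ₂, hw₁, hw₂, hex,
    LIEN.exists_isTTransform ε₁ h₁.parameter_ne_zero hF₂ hw₂, ?_, ?_⟩
  · intro γ₂₁ γ₁₂ h₂₁ h₁₂
    obtain ⟨hl₂₁, hb₂₁, -⟩ := h₁.isLIENSolution_f21 hJ hI hγ h₂₁ hf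
    obtain ⟨hl₁₂, hb₁₂, -⟩ :=
      h₂.isLIENSolution_f21 hJ hI hγ (LIEN.f12_eq_f21 ξ₁ ξ₂ f₁ f₂ ▸ h₁₂) hf'
    refine ⟨fun s hs t ht => ?_, hl₂₁, hl₁₂, hb₂₁, fun s hs t ht => ?_⟩
    · rw [h₂₁.eq_plusFrame_mul_inv hJ hI hF₁ hs ht, h₁₂.eq_plusFrame_mul_inv hJ hI hF₂ hs ht,
        LIEN.plusFrame_plusFrame _ _ (hf s hs t ht), LIEN.minusFrame_minusFrame (hf s hs t ht)]
    · rw [hb₁₂ s hs t ht, LIEN.kappa21_swap]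
  -- KdV holds because `kappa21` is the bending of an actual LIEN solution, supplied by the
  -- existence of the composite.
  · obtain ⟨γ₂₁, h₂₁⟩ := hex
    exact (h₁.isLIENSolution_f21 hJ hI hγ h₂₁ hf).2.2
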